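/- **Proposition 4.1.** Let $\Omega\subset\mathbb{R}^2$ be a Jordan domain (a bounded domain whose boundary $\partial\Omega$ is a Jordan curve) and let $\alpha\in(0,1)$. Suppose that $\Omega$ has the LQC property and that $\partial\Omega$ has the weak chord-arc property. Then the surface $$\Sigma(\Omega,t^{\alpha})=\{(x,z)\in\mathbb{R}^2\times\mathbb{R}\colon x\in\overline{\Omega},\ z=\pm\,\mathrm{dist}(x,\partial\Omega)^{\alpha}\}\subset\mathbb{R}^3,$$ with the Euclidean metric of $\mathbb{R}^3$, is Ahlfors $2$-regular. Here the terms have the following meaning. * $\Omega$ has the *level quasicircle (LQC) property* if there are $\epsilon_0>0$ and $K\ge 1$ such that for every $\epsilon\in[0,\epsilon_0]$ the level set $\gamma_\epsilon=\{x\in\overline\Omega\colon \mathrm{dist}(x,\partial\Omega)=\epsilon\}$ is a $K$-quasicircle, i.e. the image of the unit circle under a $K$-quasiconformal homeomorphism of $\mathbb{R}^2$. A homeomorphism $f$ of $\mathbb{R}^2$ is $K$-quasiconformal if $K^{-1}\,\mathrm{Mod}(\mathcal{G})\le \mathrm{Mod}(f\mathcal{G})\le K\,\mathrm{Mod}(\mathcal{G})$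 for every family $\mathcal{G}$ of (compact) curves in $\mathbb{R}^2$, where $\mathrm{Mod}(\mathcal G)=\inf_\rho\int_{\mathbb{R}^2}\rho^2$ over all Borel $\rho\colon\mathbb{R}^2\to[0,\infty]$ with $\int_\gamma\rho\,ds\ge1$ for every rectifiable $\gamma\in\mathcal{G}$. * For a Jordan curve or arc $\Gamma$, a *partition* of $\Gamma$ is a finite set $\mathscr{P}$ of subarcs of $\Gamma$, mutually disjoint except for their endpoints, whose union is $\Gamma$. It is a *$\delta$-partition* if $\frac{\delta}{2}\,\mathrm{diam}\,\Gamma\le \mathrm{diam}\,\Gamma'\le\delta\,\mathrm{diam}\,\Gamma$ for all $\Gamma'\in\mathscr{P}$. Put $M(\Gamma,\mathscr{P})=\frac{1}{\mathrm{diam}\,\Gamma}\sum_{\Gamma'\in\mathscr{P}}\mathrm{diam}\,\Gamma'$. The curve $\Gamma$ has the *weak chord-arc property* if there is $M_0>0$ such that every subarc $\Gamma'\subset\Gamma$ with $\mathrm{diam}\,\Gamma'<1$ has a $(\mathrm{diam}\,\Gamma')$-partition $\mathscr{P}$ with $M(\Gamma',\mathscr{P})\le M_0$. (Subarcs are closed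 and non-degenerate.) * A metric space $X$ is *Ahlfors $2$-regular* if there is a constant $C>1$ such that $C^{-1}r^2\le\mathcal{H}^2(B(a,r))\le Cr^2$ for every $a\in X$ and every $0<r\le\mathrm{diam}\,X$, where $B(a,r)$ is the open ball in $X$ and $\mathcal{H}^2$ is the $2$-dimensional Hausdorff measure. -/

import Mathlib

open Set MeasureTheory
open scoped ENNReal MeasureTheory

namespace DoubleDome

/-- The Euclidean plane. -/
abbrev Plane : Type := EuclideanSpace ℝ (Fin 2)

/-- Euclidean three-space. -/
abbrev Space : Type := EuclideanSpace ℝ (Fin 3)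

/-! ### Jordan curves, arcs, Jordan domains -/

/-- A Jordan curve: a homeomorphic image of the circle (`Circle` is compact, so a continuous
injection is an embedding). -/
def IsJordanCurve (Γ : Set Plane) : Prop :=
  ∃ c : Circle → Plane, Continuous c ∧ Function.Injective c ∧ range c = Γ

/-- `A` is a (closed, non-degenerate) Jordan arc with endpoints `p` and `q`. -/
def IsArcJoining (A : Set Plane) (p q : Plane) : Prop :=
  ∃ c : unitInterval → Plane,
    Continuous c ∧ Function.Injective c ∧ c 0 = p ∧ c 1 = q ∧ range c = A

/-- `A` is a (closed, non-degenerate) Jordan arc. -/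
def IsArc (A : Set Plane) : Prop := ∃ p q, IsArcJoining A p q

/-- The set of the two endpoints of an arc. -/
def arcEndpoints (A : Set Plane) : Set Plane := {p | ∃ q, IsArcJoining A p q}

/-- `A` is a subarc of `Γ`. -/
def IsSubarc (A Γ : Set Plane) : Prop := IsArc A ∧ A ⊆ Γ

/-- A planar Jordan domain: a bounded domain whose boundary is a Jordan curve. -/
structure IsJordanDomain (Ω : Set Plane) : Prop where
  isOpen : IsOpen Ω
  isConnected : IsConnected Ω
  isBounded : Bornology.IsBounded Ω
  isJordanCurve_frontier : IsJordanCurve (frontier Ω)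

/-! ### Quasiconformal maps (geometric definition) and quasicircles -/

/-- A (parametrized, compact) curve in the plane. -/
abbrev Curve : Type := C(unitInterval, Plane)

/-- The length of a curve. -/
noncomputable def Curve.length (γ : Curve) : ℝ≥0∞ := eVariationOn γ univ

/-- The integral `∫_γ ρ ds` with respect to arc length of a Borel function along a rectifiable
curve, computed in the arc-length parametrization. -/
noncomputable def Curve.lineIntegral (γ : Curve) (ρ : Plane → ℝ≥0∞) : ℝ≥0∞ :=
  ∫⁻ s in Icc (0 : ℝ) γ.length.toReal, ρ (naturalParameterization γ univ 0 s)

/-- `ρ` is admissible for the curve family `𝒢`: it is a Borel function with `∫_γ ρ ds ≥ 1` for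
every rectifiable `γ ∈ 𝒢`. -/
def IsAdmissible (𝒢 : Set Curve) (ρ : Plane → ℝ≥0∞) : Prop :=
  Measurable ρ ∧ ∀ γ ∈ 𝒢, γ.length ≠ ∞ → 1 ≤ γ.lineIntegral ρ

/-- The conformal modulus (`2`-modulus) of a family of curves in the plane. -/
noncomputable def modulus (𝒢 : Set Curve) : ℝ≥0∞ :=
  ⨅ (ρ : Plane → ℝ≥0∞) (_ : IsAdmissible 𝒢 ρ), ∫⁻ x, ρ x ^ 2

/-- The image of a family of curves under a homeomorphism of the plane. -/
def imageFamily (f : Plane ≃ₜ Plane) (𝒢 : Set Curve) : Set Curve :=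
  (fun γ : Curve => (f : C(Plane, Plane)).comp γ) '' 𝒢

/-- `f` is a `K`-quasiconformal homeomorphism of the plane: for every curve family `𝒢`,
`K⁻¹ Mod 𝒢 ≤ Mod (f 𝒢) ≤ K Mod 𝒢`. -/
def IsQuasiconformal (K : ℝ) (f : Plane ≃ₜ Plane) : Prop :=
  1 ≤ K ∧ ∀ 𝒢 : Set Curve,
    modulus 𝒢 ≤ ENNReal.ofReal K * modulus (imageFamily f 𝒢) ∧
    modulus (imageFamily f 𝒢) ≤ ENNReal.ofReal K * modulus 𝒢

/-- A `K`-quasicircle: the image of the unit circle under a `K`-quasiconformal homeomorphism of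
the plane. -/
def IsQuasicircle (K : ℝ) (Γ : Set Plane) : Prop :=
  ∃ f : Plane ≃ₜ Plane, IsQuasiconformal K f ∧ f '' Metric.sphere (0 : Plane) 1 = Γ

/-! ### The level quasicircle property -/

/-- The `ε`-level set `{x ∈ closure Ω : dist(x, ∂Ω) = ε}`. -/
def levelSet (Ω : Set Plane) (ε : ℝ) : Set Plane :=
  {x | x ∈ closure Ω ∧ Metric.infDist x (frontier Ω) = ε}

/-- The level quasicircle property. -/
def HasLQC (Ω : Set Plane) : Prop :=
  ∃ ε₀ > (0 : ℝ), ∃ K ≥ (1 : ℝ), ∀ ε ∈ Icc (0 : ℝ) ε₀, IsQuasicircle K (levelSet Ω ε)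

/-! ### The weak chord-arc property -/

/-- A partition of `Γ`: a finite set of subarcs of `Γ`, mutually disjoint except for their
endpoints, whose union is `Γ`. -/
structure IsArcPartition (Γ : Set Plane) (P : Finset (Set Plane)) : Prop where
  isSubarc : ∀ A ∈ P, IsSubarc A Γ
  inter_subset : ∀ A ∈ P, ∀ B ∈ P, A ≠ B → A ∩ B ⊆ arcEndpoints A ∩ arcEndpoints B
  iUnion_eq : ⋃ A ∈ P, A = Γ

/-- A `δ`-partition of `Γ`: a partition into subarcs of diameter between `(δ / 2) diam Γ` and
`δ diam Γ`. -/
def IsDeltaPartition (δ : ℝ) (Γ : Set Plane) (P : Finset (Set Plane)) : Prop :=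
  IsArcPartition Γ P ∧ ∀ A ∈ P,
    δ / 2 * Metric.diam Γ ≤ Metric.diam A ∧ Metric.diam A ≤ δ * Metric.diam Γ

/-- The chord-arc index `M(Γ, P) = (diam Γ)⁻¹ ∑_{A ∈ P} diam A`. -/
noncomputable def chordArcIndex (Γ : Set Plane) (P : Finset (Set Plane)) : ℝ :=
  (1 / Metric.diam Γ) * ∑ A ∈ P, Metric.diam A

/-- The weak chord-arc property: for some `M₀ > 0`, every subarc `A` of `Γ` with `diam A < 1` has
a `diam A`-partition `P` with `M(A, P) ≤ M₀`. -/
def IsWeakChordArc (Γ : Set Plane) : Prop :=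
  ∃ M₀ > (0 : ℝ), ∀ A : Set Plane, IsSubarc A Γ → Metric.diam A < 1 →
    ∃ P : Finset (Set Plane), IsDeltaPartition (Metric.diam A) A P ∧ chordArcIndex A P ≤ M₀

/-! ### Ahlfors regularity and the double-dome-like surface -/

/-- Ahlfors `Q`-regularity of a metric space. -/
def IsAhlforsRegular (Q : ℝ) (X : Type*) [MetricSpace X] [MeasurableSpace X] [BorelSpace X] :
    Prop :=
  ∃ C > (1 : ℝ), ∀ (a : X) (r : ℝ), 0 < r → ENNReal.ofReal r ≤ Metric.ediam (univ : Set X) →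
    ENNReal.ofReal (C⁻¹ * r ^ Q) ≤ μH[Q] (Metric.ball a r) ∧
    μH[Q] (Metric.ball a r) ≤ ENNReal.ofReal (C * r ^ Q)

/-- The surface `Σ(Ω, t^α) = {(x, z) : x ∈ closure Ω, z = ± dist(x, ∂Ω)^α}` in three-space. -/
def doubleDome (Ω : Set Plane) (α : ℝ) : Set Space :=
  {p | ∃ x ∈ closure Ω, ∃ z : ℝ,
    (z = Metric.infDist x (frontier Ω) ^ α ∨ z = -(Metric.infDist x (frontier Ω) ^ α)) ∧
    p = !₂[x 0, x 1, z]}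

end DoubleDome

/-! Write Γ for the boundary of Ω. By the LQC property at level 0, Γ is the image of the unit
circle, and Ω the image of the unit disk, under a quasiconformal `f`. All that is needed from `f` is
one distortion estimate (`IsQuasiconformal.annulus_le`): two connected sets that are well separated
relative to the size of one of them cannot both have images crossing a fat annulus. It follows by
comparing an upper and a lower bound for the modulus of the curves joining the two sets. It yields
bounded turning of Γ and corkscrew points in Ω.

Upper bound. By bounded turning, Γ in a disk of radius r lies in two subarcs of diameter at most Cr.
A δ-partition with δ equal to the diameter squares the scale, so k iterations of the weak chord-arc
property cut such a subarc into pieces of diameter at most (Cr)^(2^k), with total diameter at most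
M^k·Cr. Hence about M^k·r/t disks of radius t cover this part of Γ once (Cr)^(2^k) ≤ t/2 and t is at
most comparable to r. Over the shell t/2 ≤ dist ≤ t, sort points by the axis direction in which the
nearest boundary point lies. In each class, over a disk of radius comparable to t, the graph is
parametrized with Lipschitz inverse by a transverse coordinate and the height, so a height window h
contributes area at most a constant times t·h. The graph over the shell in the disk thus has area at
most a constant times M^k·r·h (`exists_hausdorffMeasure_shell_le`). In a space ball of radius r, the
j-th dyadic shell has a height window of order r·2^(-αj), and a level k of order log j suffices.
Then M^k grows only polynomially in j, the series converges, and the sum is of order r²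
(`exists_hausdorffMeasure_ball_le`).

Lower bound. Near Γ, corkscrew points bring the level curves of all small depths close to the center
of the ball. These curves are connected and too large to stay there, so they cross a planar annulus
of width comparable to r. The 1-Lipschitz map (planar distance to the center, height) therefore
covers a rectangle with both sides comparable to r. Away from Γ the height is a Lipschitz function
and the vertical projection covers a square (`exists_le_hausdorffMeasure_ball`). -/

namespace DoubleDome

/-! ### Arc length and the natural parametrization. -/

open Filter Topology in
theorem continuous_variationOnFromTo_univ {α E : Type*} [LinearOrder α] [TopologicalSpace α]
    [OrderTopology α] [PseudoEMetricSpace E] {f : α → E} (hf : Continuous f)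
    (hbv : BoundedVariationOn f univ) (a : α) : Continuous (variationOnFromTo f univ a) := by
  rw [continuous_iff_continuousAt]
  intro x
  rw [continuousAt_iff_continuous_left_right]
  refine ⟨?_, hbv.continuousWithinAt_variationOnFromTo_Ici hf.continuousWithinAt⟩
  have : variationOnFromTo f univ a =
      fun y ↦ variationOnFromTo f univ a x + variationOnFromTo f univ x y := by
    ext y
    rw [variationOnFromTo.add hbv.locallyBoundedVariationOn (mem_univ _) (mem_univ _) (mem_univ _)]
  rw [this]
  apply continuousWithinAt_const.add
  suffices H : ContinuousWithinAt (fun y ↦ -(eVariationOn f (univ ∩ Icc y x)).toReal) (Iic x) x from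
    H.congr_of_mem (fun y hy ↦ variationOnFromTo.eq_of_ge f univ hy) self_mem_Iic
  apply ContinuousWithinAt.neg
  simp only [ContinuousWithinAt, Icc_self]
  rw [eVariationOn.subsingleton _ (by grind [Set.Subsingleton])]
  apply (ENNReal.tendsto_toReal ENNReal.zero_ne_top).comp
  apply Tendsto.mono_left _ (nhdsWithin_mono _ (subset_univ _))
  exact hbv.tendsto_eVariationOn_Icc_zero_left (by simpa using hf.continuousWithinAt)

namespace Curve

variable (γ : Curve)

theorem edist_le_length (s t : unitInterval) : edist (γ s) (γ t) ≤ γ.length :=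
  eVariationOn.edist_le _ (mem_univ _) (mem_univ _)

theorem variationOnFromTo_zero_one : variationOnFromTo γ univ 0 1 = γ.length.toReal := by
  rw [variationOnFromTo.eq_of_le _ _ zero_le_one, length]
  congr 2
  ext t
  simpa using unitInterval.le_one'

variable {γ}

/-- Continuity of the length function makes every parameter in `[0, length]` an attained one, so the
natural parametrization takes no default value there. -/
theorem surjOn_variationOnFromTo (hγ : γ.length ≠ ∞) :
    Icc 0 γ.length.toReal ⊆ range (variationOnFromTo γ univ 0) := by
  have hc := continuous_variationOnFromTo_univ γ.continuous (f := γ) hγ 0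
  have := intermediate_value_Icc (zero_le_one (α := unitInterval)) hc.continuousOn
  rw [variationOnFromTo.self, variationOnFromTo_zero_one] at this
  exact this.trans (image_subset_range _ _)

theorem naturalParameterization_variation (hγ : γ.length ≠ ∞) (t : unitInterval) :
    naturalParameterization γ univ 0 (variationOnFromTo γ univ 0 t) = γ t :=
  edist_eq_zero.1 (edist_naturalParameterization_eq_zero
    (BoundedVariationOn.locallyBoundedVariationOn hγ) (mem_univ _) (mem_univ _))

theorem edist_naturalParameterization_le (hγ : γ.length ≠ ∞) {s : ℝ}
    (hs : s ∈ Icc 0 γ.length.toReal) :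
    edist (naturalParameterization γ univ 0 s) (γ 0) ≤ ENNReal.ofReal s := by
  obtain ⟨t, rfl⟩ := surjOn_variationOnFromTo hγ hs
  rw [naturalParameterization_variation hγ, variationOnFromTo.eq_of_le _ _ unitInterval.nonneg',
    ENNReal.ofReal_toReal]
  · exact eVariationOn.edist_le _ (by simp) (by simp)
  · exact ne_top_of_le_ne_top hγ (eVariationOn.mono _ (subset_univ _))

theorem dist_naturalParameterization_le (hγ : γ.length ≠ ∞) {s : ℝ}
    (hs : s ∈ Icc 0 γ.length.toReal) :
    dist (naturalParameterization γ univ 0 s) (γ 0) ≤ s := by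
  have := edist_naturalParameterization_le hγ hs
  rwa [edist_dist, ENNReal.ofReal_le_ofReal_iff hs.1] at this

end Curve

/-! ### Upper bound for the modulus of a joining family. -/

/-- The family of curves starting in `E` and ending in `F`. -/
def joiningFamily (E F : Set Plane) : Set Curve := {γ | γ 0 ∈ E ∧ γ 1 ∈ F}

/-- The test function is `1/b` on the ball of radius `ρ + b`: each joining curve has length at least
`b`, and its first portion of length `b` cannot leave that ball. -/
theorem modulus_joiningFamily_le {E F : Set Plane} {m : Plane} {ρ b : ℝ} (hb : 0 < b)
    (hE : E ⊆ Metric.closedBall m ρ) (hEF : ∀ x ∈ E, ∀ y ∈ F, b ≤ dist x y) :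
    modulus (joiningFamily E F) ≤ ENNReal.ofReal (Real.pi * ((ρ + b) / b) ^ 2) := by
  set B := Metric.closedBall m (ρ + b) with hB
  have hBm : MeasurableSet B := Metric.isClosed_closedBall.measurableSet
  rcases lt_or_ge ρ 0 with hρ | hρ
  · have hE' : E = ∅ := by
      rw [Metric.closedBall_eq_empty.2 hρ] at hE
      exact subset_empty_iff.1 hE
    refine (iInf₂_le (fun _ => 0) ⟨measurable_const, fun γ hγ => ?_⟩).trans (by simp)
    simp [joiningFamily, hE'] at hγ
  have hadm : IsAdmissible (joiningFamily E F) (B.indicator fun _ => ENNReal.ofReal b⁻¹) := by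
    refine ⟨measurable_const.indicator hBm, fun γ hγ hl => ?_⟩
    have hL : b ≤ γ.length.toReal := by
      refine (hEF _ hγ.1 _ hγ.2).trans ?_
      rw [dist_edist]
      exact ENNReal.toReal_mono hl (γ.edist_le_length _ _)
    calc (1 : ℝ≥0∞) = ∫⁻ s in Icc (0 : ℝ) b, ENNReal.ofReal b⁻¹ := by
          rw [setLIntegral_const, Real.volume_Icc, ← ENNReal.ofReal_mul (by positivity), sub_zero,
            inv_mul_cancel₀ hb.ne', ENNReal.ofReal_one]
      _ ≤ ∫⁻ s in Icc (0 : ℝ) b, (B.indicator fun _ => ENNReal.ofReal b⁻¹)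
            (naturalParameterization γ univ 0 s) := by
          refine setLIntegral_mono' measurableSet_Icc fun s hs => ?_
          rw [indicator_of_mem]
          have h1 := Curve.dist_naturalParameterization_le hl ⟨hs.1, hs.2.trans hL⟩
          have h2 : dist (γ 0) m ≤ ρ := hE hγ.1
          rw [hB, Metric.mem_closedBall]
          linarith [dist_triangle (naturalParameterization γ univ 0 s) (γ 0) m, hs.2]
      _ ≤ γ.lineIntegral _ := lintegral_mono_set (Icc_subset_Icc_right hL)
  · refine (iInf₂_le _ hadm).trans ?_
    have : ∀ x, (B.indicator (fun _ => ENNReal.ofReal b⁻¹) x) ^ 2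
        = B.indicator (fun _ => ENNReal.ofReal b⁻¹ ^ 2) x := by
      intro x
      by_cases hx : x ∈ B <;> simp [hx]
    simp_rw [this]
    rw [lintegral_indicator hBm, setLIntegral_const, hB, EuclideanSpace.volume_closedBall_fin_two,
      ← ENNReal.ofReal_pow (by positivity), ← ENNReal.ofReal_pow (by positivity),
      ← ENNReal.ofReal_mul (by positivity), ← ENNReal.ofReal_mul (by positivity)]
    refine ENNReal.ofReal_le_ofReal (le_of_eq ?_)
    field_simp

/-! ### Line integrals along Lipschitz curves. -/

theorem Curve.lipschitzWith_variation {γ : Curve} {K : NNReal} (hγ : LipschitzWith K γ) :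
    γ.length ≠ ∞ ∧ LipschitzWith K (variationOnFromTo γ univ 0) := by
  have hmono : ∀ s : Set unitInterval, MonotoneOn (fun t : unitInterval => (t : ℝ)) s :=
    fun s x _ y _ h => h
  have key : ∀ a b : unitInterval, a ≤ b →
      eVariationOn γ (univ ∩ Icc a b) ≤ K * ENNReal.ofReal (b - a) := by
    intro a b hab
    -- Extending `γ` to the line factors it through the inclusion of the interval in `ℝ`, a monotone
    -- map whose variation on `[a, b]` is `b - a`.
    let g : ℝ → Plane := fun x => γ (projIcc 0 1 zero_le_one x)
    have hg : LipschitzWith K g := by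
      simpa [Function.comp_def] using hγ.comp (LipschitzWith.projIcc (zero_le_one (α := ℝ)))
    have h1 : eVariationOn (g ∘ fun t : unitInterval => (t : ℝ)) (univ ∩ Icc a b)
        ≤ K * eVariationOn (fun t : unitInterval => (t : ℝ)) (univ ∩ Icc a b) :=
      (hg.lipschitzOnWith (s := univ)).comp_eVariationOn_le (fun _ _ => mem_univ _)
    have h2 : g ∘ (fun t : unitInterval => (t : ℝ)) = γ := by
      ext1 t
      simp [g, projIcc_val]
    rw [h2] at h1
    refine h1.trans ?_
    gcongr
    exact ((hmono univ).eVariationOn_eq (mem_univ _) (mem_univ _)).le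
  have hlen : γ.length ≠ ∞ := by
    have := key 0 1 zero_le_one
    have h3 : (univ ∩ Icc (0 : unitInterval) 1) = univ := by
      ext t; simpa using unitInterval.le_one'
    rw [h3] at this
    exact ne_top_of_le_ne_top (by finiteness) this
  refine ⟨hlen, ?_⟩
  have hlbv := BoundedVariationOn.locallyBoundedVariationOn (f := γ) (s := univ) hlen
  refine LipschitzWith.of_dist_le_mul fun x y => ?_
  wlog hxy : x ≤ y generalizing x y
  · rw [dist_comm, dist_comm x]
    exact this y x (le_of_not_ge hxy)
  have h1 := variationOnFromTo.sub_right hlbv (mem_univ 0) (mem_univ y) (mem_univ x)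
  rw [dist_comm, Real.dist_eq, h1, variationOnFromTo.eq_of_le _ _ hxy,
    abs_of_nonneg ENNReal.toReal_nonneg, Subtype.dist_eq, Real.dist_eq, abs_sub_comm,
    abs_of_nonneg (sub_nonneg.2 (show (x : ℝ) ≤ y from hxy))]
  refine ENNReal.toReal_le_of_le_ofReal (by have : (x : ℝ) ≤ y := hxy; have := sub_nonneg.2 this; positivity) ?_
  rw [ENNReal.ofReal_mul K.coe_nonneg, ENNReal.ofReal_coe_nnreal]
  exact key x y hxy

theorem volume_image_le_of_lipschitzWith {K : NNReal} {v : ℝ → ℝ} (hv : LipschitzWith K v)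
    (s : Set ℝ) : volume (v '' s) ≤ K * volume s := by
  have := hv.hausdorffMeasure_image_le (d := 1) zero_le_one s
  simpa [hausdorffMeasure_real] using this

/-- Change of variables bound for a line integral. -/
theorem Curve.lineIntegral_le {γ : Curve} (hγ : γ.length ≠ ∞) {φ : ℝ → unitInterval} {I : Set ℝ}
    (hφ : φ '' I = univ) {K : NNReal}
    (hK : LipschitzWith K fun x => variationOnFromTo γ univ 0 (φ x)) (ρ : Plane → ℝ≥0∞) :
    γ.lineIntegral ρ ≤ K * ∫⁻ x in I, ρ (γ (φ x)) := by
  set v : ℝ → ℝ := fun x => variationOnFromTo γ univ 0 (φ x) with hv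
  -- The `K`-Lipschitz map `v` sends `I` onto a set containing `[0, length]`, so Lebesgue measure
  -- there is at most `K` times the push-forward of Lebesgue measure on `I`.
  have hle : volume.restrict (Icc (0 : ℝ) γ.length.toReal)
      ≤ (K : ℝ≥0∞) • (volume.restrict I).map v := by
    refine Measure.le_iff.2 fun S hS => ?_
    rw [Measure.restrict_apply hS, Measure.smul_apply,
      Measure.map_apply hK.continuous.measurable hS,
      Measure.restrict_apply (hK.continuous.measurable hS), smul_eq_mul]
    refine (measure_mono ?_).trans (volume_image_le_of_lipschitzWith hK _)
    rintro x ⟨hxS, hx⟩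
    obtain ⟨t, rfl⟩ := surjOn_variationOnFromTo hγ hx
    obtain ⟨y, hy, rfl⟩ : t ∈ φ '' I := hφ ▸ mem_univ t
    exact ⟨y, ⟨hxS, hy⟩, rfl⟩
  calc γ.lineIntegral ρ ≤ ∫⁻ s, ρ (naturalParameterization γ univ 0 s)
          ∂((K : ℝ≥0∞) • (volume.restrict I).map v) := lintegral_mono' hle le_rfl
    _ = K * ∫⁻ s, ρ (naturalParameterization γ univ 0 s) ∂((volume.restrict I).map v) := by
        rw [lintegral_smul_measure, smul_eq_mul]
    _ ≤ K * ∫⁻ x in I, ρ (naturalParameterization γ univ 0 (v x)) := by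
        exact mul_le_mul_right (lintegral_map_le (μ := volume.restrict I) _ v) _
    _ = K * ∫⁻ x in I, ρ (γ (φ x)) := by
        simp only [hv, naturalParameterization_variation hγ]

/-! ### Circles, polar coordinates and the lower bound for the modulus. -/

/-- The point of the unit circle with angle `θ`. -/
noncomputable def circlePt (θ : ℝ) : Plane := !₂[Real.cos θ, Real.sin θ]

theorem dist_circlePt (x y : ℝ) : dist (circlePt x) (circlePt y) = 2 * |Real.sin ((x - y) / 2)| := by
  rw [EuclideanSpace.dist_eq, Real.sqrt_eq_iff_mul_self_eq (by positivity) (by positivity)]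
  simp only [circlePt, Fin.sum_univ_two, Real.dist_eq, sq_abs]
  simp only [Matrix.cons_val_zero, Matrix.cons_val_one]
  rw [Real.cos_sub_cos, Real.sin_sub_sin]
  have := Real.sin_sq_add_cos_sq ((x + y) / 2)
  have h2 := abs_mul_abs_self (Real.sin ((x - y) / 2))
  linear_combination 4 * Real.sin ((x - y) / 2) ^ 2 * this - 4 * h2

theorem lipschitzWith_circlePt : LipschitzWith 1 circlePt := by
  refine LipschitzWith.of_dist_le_mul fun x y => ?_
  rw [dist_circlePt, Real.dist_eq, NNReal.coe_one, one_mul]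
  have : |Real.sin ((x - y) / 2)| ≤ |(x - y) / 2| := Real.abs_sin_le_abs
  rw [abs_div, abs_two] at this
  linarith

theorem norm_circlePt (θ : ℝ) : ‖circlePt θ‖ = 1 := by
  rw [EuclideanSpace.norm_eq]
  simp [circlePt, Fin.sum_univ_two]

theorem exists_circlePt (x : Plane) : ∃ θ ∈ Ioc (-Real.pi) Real.pi, x = ‖x‖ • circlePt θ := by
  set z : ℂ := ⟨x 0, x 1⟩ with hz
  have hn : ‖z‖ = ‖x‖ := by
    rw [EuclideanSpace.norm_eq, Fin.sum_univ_two, Complex.norm_def, Complex.normSq_apply]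
    simp [hz, sq]
  refine ⟨z.arg, Complex.arg_mem_Ioc z, ?_⟩
  rw [← hn]
  ext i
  fin_cases i
  · simp [circlePt, Complex.norm_mul_cos_arg, hz]
  · simp [circlePt, Complex.norm_mul_sin_arg, hz]

open Real in
/-- An admissible function for the curves joining `E` to `F` has large integral over each circle
meeting both. -/
theorem one_le_circle_integral {E F : Set Plane} {ρ : Plane → ℝ≥0∞}
    (hρ : IsAdmissible (joiningFamily E F) ρ) {w : Plane} {s : ℝ} (hs : 0 < s) {θ₁ θ₂ : ℝ}
    (h₁ : θ₁ ∈ Icc (-π) π) (h₂ : θ₂ ∈ Icc (-π) π)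
    (hE : w + s • circlePt θ₁ ∈ E) (hF : w + s • circlePt θ₂ ∈ F) :
    1 ≤ ENNReal.ofReal s * ∫⁻ θ in Icc (-π) π, ρ (w + s • circlePt θ) := by
  let γ : Curve := ⟨fun t => w + s • circlePt (θ₁ + t * (θ₂ - θ₁)), by
    have := lipschitzWith_circlePt.continuous
    fun_prop⟩
  have hγ : γ ∈ joiningFamily E F := ⟨by simpa [γ] using hE, by simpa [γ] using hF⟩
  have hLip : LipschitzWith (s * |θ₂ - θ₁|).toNNReal γ := by
    refine LipschitzWith.of_dist_le_mul fun x y => ?_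
    rw [Real.coe_toNNReal _ (by positivity)]
    simp only [γ, ContinuousMap.coe_mk, dist_add_left]
    rw [dist_smul₀, Real.norm_of_nonneg hs.le, mul_assoc]
    gcongr
    refine (lipschitzWith_circlePt.dist_le_mul _ _).trans (le_of_eq ?_)
    rw [NNReal.coe_one, one_mul, dist_add_left, Real.dist_eq, ← sub_mul, abs_mul, mul_comm,
      Subtype.dist_eq, Real.dist_eq]
  obtain ⟨hlen, hv⟩ := Curve.lipschitzWith_variation hLip
  have hadm := hρ.2 γ hγ hlen
  -- If the angles agree, the constant curve belongs to the family; its line integral vanishes, so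
  -- no admissible function exists.
  rcases eq_or_ne θ₁ θ₂ with h | h
  · exfalso
    have : γ.length.toReal = 0 := by
      have h1 := hv.dist_le_mul 1 0
      rw [h, sub_self, abs_zero, mul_zero, Real.toNNReal_zero, NNReal.coe_zero, zero_mul,
        variationOnFromTo.self, Curve.variationOnFromTo_zero_one, Real.dist_0_eq_abs] at h1
      exact abs_eq_zero.1 (le_antisymm h1 (abs_nonneg _))
    rw [Curve.lineIntegral, this] at hadm
    simp at hadm
  have hd : θ₂ - θ₁ ≠ 0 := sub_ne_zero.2 h.symm
  -- `φ` inverts the affine parametrization by angle. The factor `|θ₂ - θ₁|` then cancels, and arc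
  -- length is `s`-Lipschitz in the angle.
  let φ : ℝ → unitInterval := fun x => projIcc 0 1 zero_le_one ((x - θ₁) / (θ₂ - θ₁))
  let I : Set ℝ := (fun t : unitInterval => θ₁ + t * (θ₂ - θ₁)) '' univ
  have hφI : ∀ t : unitInterval, φ (θ₁ + t * (θ₂ - θ₁)) = t := by
    intro t
    simp only [φ, add_sub_cancel_left, mul_div_assoc, div_self hd, mul_one, projIcc_val]
  have hφ : φ '' I = univ := by
    refine eq_univ_of_forall fun t => ⟨_, ⟨t, mem_univ t, rfl⟩, hφI t⟩
  have hI : I ⊆ Icc (-π) π := by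
    rintro _ ⟨t, -, rfl⟩
    have h0 := t.2.1
    have h1 := t.2.2
    constructor
    · nlinarith [h₁.1, h₂.1]
    · nlinarith [h₁.2, h₂.2]
  have hK : LipschitzWith s.toNNReal fun x => variationOnFromTo γ univ 0 (φ x) := by
    refine LipschitzWith.of_dist_le_mul fun x y => ?_
    refine (hv.dist_le_mul _ _).trans ?_
    rw [Real.coe_toNNReal _ (by positivity), Real.coe_toNNReal _ hs.le, mul_assoc]
    gcongr
    have := (LipschitzWith.projIcc (zero_le_one (α := ℝ))).dist_le_mul
      ((x - θ₁) / (θ₂ - θ₁)) ((y - θ₁) / (θ₂ - θ₁))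
    rw [NNReal.coe_one, one_mul, Real.dist_eq, ← sub_div, sub_sub_sub_cancel_right, abs_div] at this
    rw [Real.dist_eq]
    calc |θ₂ - θ₁| * dist (φ x) (φ y) ≤ |θ₂ - θ₁| * (|x - y| / |θ₂ - θ₁|) := by gcongr
      _ = |x - y| := by field_simp
  have hmain := Curve.lineIntegral_le hlen hφ hK ρ
  refine hadm.trans (hmain.trans ?_)
  change ENNReal.ofReal s * _ ≤ _
  refine mul_le_mul_right (?_) _
  calc ∫⁻ x in I, ρ (γ (φ x)) = ∫⁻ x in I, ρ (w + s • circlePt x) := by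
        refine setLIntegral_congr_fun ?_ ?_
        · have : IsCompact I := isCompact_univ.image (by fun_prop)
          exact this.isClosed.measurableSet
        · rintro _ ⟨t, -, rfl⟩
          simp only [hφI t]
          rfl
    _ ≤ _ := lintegral_mono_set hI

theorem measurable_circlePt : Measurable circlePt := lipschitzWith_circlePt.continuous.measurable

open Real in
theorem lintegral_plane_polar {g : Plane → ℝ≥0∞} (hg : Measurable g) (w : Plane) :
    ∫⁻ x, g x = ∫⁻ s in Ioi (0 : ℝ), ENNReal.ofReal s *
      ∫⁻ θ in Ioo (-π) π, g (w + s • circlePt θ) := by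
  let T : Plane ≃ᵐ ℝ × ℝ :=
    (MeasurableEquiv.toLp 2 (Fin 2 → ℝ)).symm.trans MeasurableEquiv.finTwoArrow
  have hT : MeasurePreserving T volume volume :=
    (EuclideanSpace.volume_preserving_symm_measurableEquiv_toLp (Fin 2)).trans
      (volume_preserving_finTwoArrow ℝ)
  have h1 : ∫⁻ x, g x = ∫⁻ x, g (w + x) := (lintegral_add_left_eq_self g w).symm
  have h2 : ∫⁻ x, g (w + x) = ∫⁻ p : ℝ × ℝ, g (w + T.symm p) := by
    rw [← hT.lintegral_comp_emb T.measurableEmbedding]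
    simp
  rw [h1, h2, ← lintegral_comp_polarCoord_symm, polarCoord_target, Measure.volume_eq_prod,
    ← Measure.prod_restrict, lintegral_prod]
  · refine lintegral_congr fun s => ?_
    rw [← lintegral_const_mul]
    · refine lintegral_congr fun θ => ?_
      rw [smul_eq_mul]
      congr 3
      ext i
      fin_cases i <;> simp [T, circlePt, polarCoord, MeasurableEquiv.finTwoArrow]
    · exact hg.comp (by have := measurable_circlePt; fun_prop)
  · refine Measurable.aemeasurable ?_
    refine (measurable_fst.ennreal_ofReal).smul (hg.comp (measurable_const.add
      (T.symm.measurable.comp ?_)))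
    exact continuous_polarCoord_symm.measurable

/-- The set `E` meets both sides of the annulus with center `w` and radii `η` and `R`. -/
def CrossesAnnulus (w : Plane) (η R : ℝ) (E : Set Plane) : Prop :=
  (∃ x ∈ E, dist x w ≤ η) ∧ ∃ x ∈ E, R ≤ dist x w

theorem CrossesAnnulus.exists_circlePt_mem {w : Plane} {η R : ℝ} {E : Set Plane}
    (h : CrossesAnnulus w η R E) (hE : IsPreconnected E) {s : ℝ} (hs : s ∈ Ioo η R) :
    ∃ θ ∈ Icc (-Real.pi) Real.pi, w + s • circlePt θ ∈ E := by
  obtain ⟨⟨x, hx, hxη⟩, y, hy, hyR⟩ := h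
  obtain ⟨z, hz, hzs⟩ := hE.intermediate_value hx hy (f := fun z => dist z w)
    (by fun_prop) ⟨hxη.trans hs.1.le, hs.2.le.trans hyR⟩
  obtain ⟨θ, hθ, hθz⟩ := exists_circlePt (z - w)
  refine ⟨θ, ⟨hθ.1.le, hθ.2⟩, ?_⟩
  simp only [dist_eq_norm] at hzs
  rw [← hzs, ← hθz]
  simpa using hz

open Real in
theorem sq_lintegral_le {f : ℝ → ℝ≥0∞} (hf : Measurable f) :
    (∫⁻ θ in Icc (-π) π, f θ) ^ 2 ≤ ENNReal.ofReal (2 * π) * ∫⁻ θ in Icc (-π) π, f θ ^ 2 := by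
  have h := ENNReal.lintegral_mul_le_Lp_mul_Lq (volume.restrict (Icc (-π) π))
    Real.HolderConjugate.two_two (f := f) (g := 1) hf.aemeasurable measurable_one.aemeasurable
  simp only [mul_one, Pi.one_apply, ENNReal.one_rpow, lintegral_const, one_mul,
    Measure.restrict_apply_univ, Real.volume_Icc, sub_neg_eq_add, ← two_mul] at h
  calc (∫⁻ θ in Icc (-π) π, f θ) ^ 2
      ≤ ((∫⁻ θ in Icc (-π) π, f θ ^ (2 : ℝ)) ^ (1 / 2 : ℝ) *
          ENNReal.ofReal (2 * π) ^ (1 / 2 : ℝ)) ^ 2 := by gcongr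
    _ = _ := by
      rw [mul_pow, ← ENNReal.rpow_natCast, ← ENNReal.rpow_natCast, ← ENNReal.rpow_mul,
        ← ENNReal.rpow_mul]
      norm_num
      rw [mul_comm]

-- Each circle of radius `s` between `η` and `R` meets both connected sets, so an admissible `ρ` has
-- integral at least 1 on it. Cauchy–Schwarz gives `∫ ρ²` at least `1 / (2πs)` along the circle, and
-- integrating in `s` produces the logarithm.
open Real in
theorem le_modulus_joiningFamily {E F : Set Plane} (hE : IsPreconnected E) (hF : IsPreconnected F)
    {w : Plane} {η R : ℝ} (hη : 0 < η) (hR : η ≤ R) (hEw : CrossesAnnulus w η R E)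
    (hFw : CrossesAnnulus w η R F) :
    ENNReal.ofReal (log (R / η) / (2 * π)) ≤ modulus (joiningFamily E F) := by
  refine le_iInf₂ fun ρ hρ => ?_
  have hm : Measurable fun x => ρ x ^ 2 := hρ.1.pow_const 2
  rw [lintegral_plane_polar hm w]
  have key : ∀ s ∈ Ioo η R, ENNReal.ofReal (1 / s * (2 * π)⁻¹) ≤ ENNReal.ofReal s *
      ∫⁻ θ in Ioo (-π) π, ρ (w + s • circlePt θ) ^ 2 := by
    intro s hs
    have hs0 : 0 < s := hη.trans hs.1
    obtain ⟨θ₁, h₁, hE'⟩ := hEw.exists_circlePt_mem hE hs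
    obtain ⟨θ₂, h₂, hF'⟩ := hFw.exists_circlePt_mem hF hs
    have h := one_le_circle_integral hρ hs0 h₁ h₂ hE' hF'
    have hmeas : Measurable fun θ => ρ (w + s • circlePt θ) :=
      hρ.1.comp (by have := measurable_circlePt; fun_prop)
    have hcs := sq_lintegral_le hmeas
    rw [setLIntegral_congr Ioo_ae_eq_Icc]
    set J := ∫⁻ θ in Icc (-π) π, ρ (w + s • circlePt θ) ^ 2
    set A := ∫⁻ θ in Icc (-π) π, ρ (w + s • circlePt θ)
    have h3 : (1 : ℝ≥0∞) ≤ ENNReal.ofReal (s * (2 * π)) * (ENNReal.ofReal s * J) := by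
      calc (1 : ℝ≥0∞) = 1 ^ 2 := by simp
        _ ≤ (ENNReal.ofReal s * A) ^ 2 := by gcongr
        _ = ENNReal.ofReal s ^ 2 * A ^ 2 := mul_pow _ _ _
        _ ≤ ENNReal.ofReal s ^ 2 * (ENNReal.ofReal (2 * π) * J) := by gcongr
        _ = _ := by rw [ENNReal.ofReal_mul hs0.le]; ring
    have h4 : ENNReal.ofReal (1 / s * (2 * π)⁻¹) = (ENNReal.ofReal (s * (2 * π)))⁻¹ := by
      rw [← ENNReal.ofReal_inv_of_pos (by positivity)]
      congr 1
      field_simp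
    rw [h4, ENNReal.inv_le_iff_le_mul (fun _ => by simp; positivity) (by simp)]
    exact h3
  have hint : IntervalIntegrable (fun s : ℝ => 1 / s) volume η R := by
    apply intervalIntegral.intervalIntegrable_one_div
    · intro x hx
      rw [uIcc_of_le hR] at hx
      exact (hη.trans_le hx.1).ne'
    · exact continuousOn_id
  calc ENNReal.ofReal (log (R / η) / (2 * π))
      = ENNReal.ofReal (∫ s in Ioc η R, 1 / s * (2 * π)⁻¹) := by
        congr 1
        rw [← intervalIntegral.integral_of_le hR, intervalIntegral.integral_mul_const,
          integral_one_div, div_eq_mul_inv]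
        rw [uIcc_of_le hR]
        exact fun h => absurd h.1 (not_le.2 hη)
    _ = ∫⁻ s in Ioc η R, ENNReal.ofReal (1 / s * (2 * π)⁻¹) := by
        rw [ofReal_integral_eq_lintegral_ofReal]
        · exact ((intervalIntegrable_iff_integrableOn_Ioc_of_le hR).1 hint).mul_const _
        · refine (ae_restrict_iff' measurableSet_Ioc).2 (Filter.Eventually.of_forall fun s hs => ?_)
          have : 0 < s := hη.trans hs.1
          simp only [Pi.zero_apply]
          positivity
    _ = ∫⁻ s in Ioo η R, ENNReal.ofReal (1 / s * (2 * π)⁻¹) :=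
        (setLIntegral_congr Ioo_ae_eq_Ioc).symm
    _ ≤ ∫⁻ s in Ioo η R, ENNReal.ofReal s *
          ∫⁻ θ in Ioo (-π) π, ρ (w + s • circlePt θ) ^ 2 :=
        setLIntegral_mono' measurableSet_Ioo key
    _ ≤ _ := lintegral_mono_set fun s hs => hη.trans hs.1

/-! ### Distortion under quasiconformal maps. -/

theorem imageFamily_joiningFamily (f : Plane ≃ₜ Plane) (E F : Set Plane) :
    imageFamily f (joiningFamily E F) = joiningFamily (f '' E) (f '' F) := by
  ext γ
  constructor
  · rintro ⟨γ, hγ, rfl⟩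
    exact ⟨⟨_, hγ.1, rfl⟩, ⟨_, hγ.2, rfl⟩⟩
  · rintro ⟨⟨x, hx, hx'⟩, y, hy, hy'⟩
    refine ⟨(f.symm : C(Plane, Plane)).comp γ, ⟨?_, ?_⟩, ?_⟩
    · simpa [← hx'] using hx
    · simpa [← hy'] using hy
    · ext1 t
      simp

open Real in
/-- The distortion estimate for quasiconformal maps that is used throughout. -/
theorem IsQuasiconformal.annulus_le {K : ℝ} {f : Plane ≃ₜ Plane} (hf : IsQuasiconformal K f)
    {E F : Set Plane} (hE : IsPreconnected E) (hF : IsPreconnected F) {m w : Plane}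
    {ρ b η R : ℝ} (hb : 0 < b) (hρb : ρ ≤ 2 * b) (hEm : E ⊆ Metric.closedBall m ρ)
    (hEF : ∀ x ∈ E, ∀ y ∈ F, b ≤ dist x y) (hη : 0 < η)
    (hEw : CrossesAnnulus w η R (f '' E)) (hFw : CrossesAnnulus w η R (f '' F)) :
    R ≤ exp (18 * π ^ 2 * K) * η := by
  have hK : 0 < K := zero_lt_one.trans_le hf.1
  rcases le_or_gt R η with hR | hR
  · exact hR.trans (le_mul_of_one_le_left hη.le (one_le_exp (by positivity)))
  have hρ : 0 ≤ ρ := by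
    obtain ⟨_, ⟨x, hx, -⟩, -⟩ := hEw.1
    exact Metric.nonempty_closedBall.1 ⟨x, hEm hx⟩
  have h1 := le_modulus_joiningFamily (hE.image f f.continuous.continuousOn)
    (hF.image f f.continuous.continuousOn) hη hR.le hEw hFw
  rw [← imageFamily_joiningFamily] at h1
  -- The chain is `log (R/η) / (2π) ≤ Mod (image) ≤ K · Mod ≤ K · π · ((ρ + b)/b)²`. With `ρ ≤ 2b`
  -- the last factor is at most 9, whence the constant `18π²K`.
  have h2 := h1.trans (((hf.2 _).2).trans (mul_le_mul_right (modulus_joiningFamily_le hb hEm hEF) _))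
  rw [← ENNReal.ofReal_mul hK.le, ENNReal.ofReal_le_ofReal_iff (by positivity),
    div_le_iff₀ (by positivity)] at h2
  have h3 : (ρ + b) / b ≤ 3 := by
    rw [div_le_iff₀ hb]; linarith
  have h4 : ((ρ + b) / b) ^ 2 ≤ 9 := by
    have : 0 ≤ (ρ + b) / b := by positivity
    nlinarith
  have h5 : log (R / η) ≤ 18 * π ^ 2 * K := by
    refine h2.trans ?_
    calc K * (π * ((ρ + b) / b) ^ 2) * (2 * π) ≤ K * (π * 9) * (2 * π) := by gcongr
      _ = _ := by ring
  rw [← div_le_iff₀ hη]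
  exact (log_le_iff_le_exp (by have := hη.trans hR; positivity)).1 h5

/-! ### Arcs of the circle and bounded turning of quasicircles. -/

theorem sphere_eq_range_circlePt : Metric.sphere (0 : Plane) 1 = range circlePt := by
  ext x
  constructor
  · intro hx
    obtain ⟨θ, -, hθ⟩ := exists_circlePt x
    rw [mem_sphere_zero_iff_norm] at hx
    rw [hx, one_smul] at hθ
    exact ⟨θ, hθ.symm⟩
  · rintro ⟨θ, rfl⟩
    simp [norm_circlePt]

theorem circlePt_add_two_pi (θ : ℝ) : circlePt (θ + 2 * Real.pi) = circlePt θ := by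
  simp [circlePt]

theorem circlePt_add_pi (θ : ℝ) : circlePt (θ + Real.pi) = -circlePt θ := by
  ext i
  fin_cases i <;> simp [circlePt]

-- Jordan's inequality `sin x ≥ 2x/π` on `[0, π/2]`, applied to half the angle or, past `π/2`, to
-- its supplement.
open Real in
theorem le_dist_circlePt {x y l : ℝ} (hl : 0 ≤ l) (h₁ : l ≤ y - x) (h₂ : y - x ≤ 2 * π - l) :
    2 * l / π ≤ dist (circlePt x) (circlePt y) := by
  have key : l / π ≤ sin ((y - x) / 2) := by
    rcases le_total ((y - x) / 2) (π / 2) with h | h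
    · refine le_trans ?_ (mul_le_sin (by linarith) h)
      rw [div_mul_div_comm, mul_comm 2 (y - x), mul_div_mul_right _ _ two_ne_zero]
      gcongr
    · rw [← sin_pi_sub]
      refine le_trans ?_ (mul_le_sin (by linarith) (by linarith))
      rw [div_mul_eq_mul_div]
      gcongr
      linarith
  rw [dist_comm, dist_circlePt, mul_div_assoc]
  gcongr
  exact key.trans (le_abs_self _)

section Quasicircle

variable {K : ℝ} {f : Plane ≃ₜ Plane}

open Real

theorem isPreconnected_circlePt_image (s : Set ℝ) (hs : IsPreconnected s) :
    IsPreconnected (circlePt '' s) :=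
  hs.image _ lipschitzWith_circlePt.continuous.continuousOn

/-- The first arc has length `l` and both gaps have length at least `l`. So it lies in a ball of
radius `l`, while the arcs are `2l/π` apart, and `l ≤ 2 · (2l/π)` because `π ≤ 4`. -/
theorem IsQuasiconformal.opposite_arcs (hf : IsQuasiconformal K f) {x₀ x₁ x₂ x₃ : ℝ}
    (h₀₁ : x₀ < x₁) (h₁₂ : x₁ - x₀ ≤ x₂ - x₁) (h₃₀ : x₁ - x₀ ≤ x₀ + 2 * π - x₃) {w : Plane} {η R : ℝ} (hη : 0 < η)
    (hE : CrossesAnnulus w η R (f '' (circlePt '' Icc x₀ x₁)))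
    (hF : CrossesAnnulus w η R (f '' (circlePt '' Icc x₂ x₃))) :
    R ≤ exp (18 * π ^ 2 * K) * η := by
  have hl : 0 < x₁ - x₀ := sub_pos.2 h₀₁
  refine hf.annulus_le (isPreconnected_circlePt_image _ isPreconnected_Icc)
    (isPreconnected_circlePt_image _ isPreconnected_Icc)
    (m := circlePt x₀) (ρ := x₁ - x₀) (b := 2 * (x₁ - x₀) / π) (by positivity) ?_ ?_ ?_ hη hE hF
  · rw [mul_div_assoc', le_div_iff₀ pi_pos]
    nlinarith [pi_le_four]
  · rintro _ ⟨θ, hθ, rfl⟩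
    have := lipschitzWith_circlePt.dist_le_mul θ x₀
    rw [NNReal.coe_one, one_mul, Real.dist_eq, abs_of_nonneg (by linarith [hθ.1])] at this
    rw [Metric.mem_closedBall]
    linarith [hθ.2]
  · rintro _ ⟨θ, hθ, rfl⟩ _ ⟨θ', hθ', rfl⟩
    exact le_dist_circlePt hl.le (by linarith [hθ.2, hθ'.1]) (by linarith [hθ.1, hθ'.2])

/-- Quasicircles have bounded turning. -/
theorem IsQuasiconformal.bounded_turning (hf : IsQuasiconformal K f) {a b η : ℝ} (hη : 0 < η)
    (hab : dist (f (circlePt b)) (f (circlePt a)) ≤ η) :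
    (∀ s ∈ Icc a b, dist (f (circlePt s)) (f (circlePt a)) ≤ exp (18 * π ^ 2 * K) * η) ∨
    ∀ s ∈ Icc b (a + 2 * π),
      dist (f (circlePt s)) (f (circlePt a)) ≤ exp (18 * π ^ 2 * K) * η := by
  have hK : 0 < K := zero_lt_one.trans_le hf.1
  set C := exp (18 * π ^ 2 * K) with hC
  have hC1 : 1 ≤ C := one_le_exp (by positivity)
  have hηC : η ≤ C * η := le_mul_of_one_le_left hη.le hC1
  by_contra! h
  obtain ⟨⟨s, hs, hsd⟩, s', hs', hsd'⟩ := h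
  set g : ℝ → Plane := fun θ => f (circlePt θ) with hg
  have hper : ∀ θ, g (θ + 2 * π) = g θ := fun θ => by simp only [hg, circlePt_add_two_pi]
  have hsa : a < s := by
    rcases hs.1.eq_or_lt with rfl | h
    · rw [dist_self] at hsd; linarith [mul_pos (zero_lt_one.trans_le hC1) hη]
    · exact h
  have hsb : s < b := by
    rcases hs.2.eq_or_lt with rfl | h
    · linarith
    · exact h
  have hsb' : b < s' := by
    rcases hs'.1.eq_or_lt with rfl | h
    · linarith
    · exact h
  have hsa' : s' < a + 2 * π := by
    rcases hs'.2.eq_or_lt with rfl | h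
    · rw [circlePt_add_two_pi, dist_self] at hsd'
      linarith [mul_pos (zero_lt_one.trans_le hC1) hη]
    · exact h
  -- Using the smaller distance as outer radius lets every arc below cross the same annulus around
  -- `g a`.
  obtain ⟨R, hR, hRs, hRs'⟩ : ∃ R, C * η < R ∧ R ≤ dist (g s) (g a) ∧ R ≤ dist (g s') (g a) :=
    ⟨min (dist (g s) (g a)) (dist (g s') (g a)), lt_min hsd hsd', min_le_left _ _, min_le_right _ _⟩
  have hcross : ∀ {x y p q : ℝ}, p ∈ Icc x y → q ∈ Icc x y → dist (g p) (g a) ≤ η →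
      R ≤ dist (g q) (g a) → CrossesAnnulus (g a) η R (f '' (circlePt '' Icc x y)) :=
    fun hp hq h1 h2 => ⟨⟨_, ⟨_, ⟨_, hp, rfl⟩, rfl⟩, h1⟩, ⟨_, ⟨_, ⟨_, hq, rfl⟩, rfl⟩, h2⟩⟩
  have haη : dist (g a) (g a) ≤ η := by rw [dist_self]; exact hη.le
  have haη' : dist (g (a + 2 * π)) (g a) ≤ η := by rw [hper, dist_self]; exact hη.le
  have hbη' : dist (g (b + 2 * π)) (g a) ≤ η := by rw [hper]; exact hab
  have hsR : R ≤ dist (g (s + 2 * π)) (g a) := by rw [hper]; exact hRs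
  refine absurd hR (not_lt.2 ?_)
  -- The points `a, s, b, s'` cut the circle into four arcs, each joining a point sent near `g a`
  -- (`a` or `b`) to one sent far away (`s` or `s'`). The shortest arc is no longer than its two
  -- neighbours, so it and the opposite arc fit `opposite_arcs`.
  have hmin : (s - a ≤ b - s ∧ s - a ≤ a + 2 * π - s') ∨ (b - s ≤ s' - b ∧ b - s ≤ s - a) ∨
      (s' - b ≤ a + 2 * π - s' ∧ s' - b ≤ b - s) ∨
      (a + 2 * π - s' ≤ s - a ∧ a + 2 * π - s' ≤ s' - b) := by
    grind
  rcases hmin with ⟨h1, h2⟩ | ⟨h1, h2⟩ | ⟨h1, h2⟩ | ⟨h1, h2⟩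
  · exact hf.opposite_arcs hsa h1 h2 hη
      (hcross (left_mem_Icc.2 hsa.le) (right_mem_Icc.2 hsa.le) haη hRs)
      (hcross (left_mem_Icc.2 hsb'.le) (right_mem_Icc.2 hsb'.le) hab hRs')
  · exact hf.opposite_arcs hsb h1 (by linarith) hη
      (hcross (right_mem_Icc.2 hsb.le) (left_mem_Icc.2 hsb.le) hab hRs)
      (hcross (right_mem_Icc.2 hsa'.le) (left_mem_Icc.2 hsa'.le) haη' hRs')
  · exact hf.opposite_arcs hsb' h1 (x₃ := s + 2 * π) (by linarith) hη
      (hcross (left_mem_Icc.2 hsb'.le) (right_mem_Icc.2 hsb'.le) hab hRs')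
      (hcross (left_mem_Icc.2 (by linarith)) (right_mem_Icc.2 (by linarith)) haη' hsR)
  · exact hf.opposite_arcs hsa' (x₂ := s + 2 * π) (x₃ := b + 2 * π) (by linarith) (by linarith) hη
      (hcross (right_mem_Icc.2 hsa'.le) (left_mem_Icc.2 hsa'.le) haη' hRs')
      (hcross (right_mem_Icc.2 (by linarith)) (left_mem_Icc.2 (by linarith)) hbη' hsR)

end Quasicircle

/-! ### Jordan domains as quasidisks, and corkscrew points. -/

theorem IsPreconnected.subset_of_disjoint_frontier {X : Type*} [TopologicalSpace X] {S V : Set X}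
    (hS : IsPreconnected S) (hV : IsOpen V) (h : (S ∩ V).Nonempty) (hd : Disjoint S (frontier V)) :
    S ⊆ V := by
  refine hS.subset_left_of_subset_union hV isClosed_closure.isOpen_compl
    (disjoint_compl_right.mono_left subset_closure) (fun x hx => ?_) h
  by_cases hxV : x ∈ V
  · exact Or.inl hxV
  · refine Or.inr fun hc => disjoint_left.1 hd hx ?_
    rw [hV.frontier_eq]
    exact ⟨hc, hxV⟩

/-- The preimage `V` of `Ω` is connected, open and bounded, with the unit circle as frontier. A
point of `V` outside the disk would bring a whole ray into `V`, against boundedness. Thus `V` lies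
in the disk, and the disk, missing the frontier of `V`, lies in `V`. -/
theorem IsJordanDomain.eq_image_ball {Ω : Set Plane} (hΩ : IsJordanDomain Ω) {f : Plane ≃ₜ Plane}
    (hf : f '' Metric.sphere 0 1 = frontier Ω) : Ω = f '' Metric.ball 0 1 := by
  set V := f ⁻¹' Ω with hV
  have hVo : IsOpen V := hΩ.isOpen.preimage f.continuous
  have hVf : frontier V = Metric.sphere 0 1 := by
    rw [hV, ← f.preimage_frontier, ← hf, preimage_image_eq _ f.injective]
  have hVc : IsPreconnected V := by
    have := hΩ.isConnected.isPreconnected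
    rw [hV, ← f.image_symm]
    exact this.image _ f.symm.continuous.continuousOn
  have hVd : Disjoint V (Metric.sphere 0 1) := by
    rw [← hVf, hVo.frontier_eq]
    exact disjoint_sdiff_right
  have hVne : V.Nonempty := by
    obtain ⟨x, hx⟩ := hΩ.isConnected.nonempty
    exact ⟨f.symm x, by simpa [hV] using hx⟩
  suffices h : V = Metric.ball 0 1 by rw [← h, hV, image_preimage_eq _ f.surjective]
  have hnot : ∀ v ∈ V, ¬ 1 < ‖v‖ := by
    intro v hv hv1
    have hray : IsPreconnected ((fun t : ℝ => t • v) '' Ici 1) :=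
      isPreconnected_Ici.image _ (by fun_prop)
    have hsub : (fun t : ℝ => t • v) '' Ici 1 ⊆ V := by
      refine IsPreconnected.subset_of_disjoint_frontier hray hVo
        ⟨v, ⟨1, self_mem_Ici, one_smul _ _⟩, hv⟩ ?_
      rw [hVf, disjoint_left]
      rintro _ ⟨t, ht, rfl⟩ h
      rw [mem_sphere_zero_iff_norm, norm_smul, Real.norm_of_nonneg (zero_le_one.trans ht)] at h
      have : (1 : ℝ) ≤ t := ht
      nlinarith
    have hb : Bornology.IsBounded V := by
      have h1 : IsCompact (closure Ω) := hΩ.isBounded.isCompact_closure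
      have h2 := (h1.image f.symm.continuous).isBounded
      rw [f.image_symm] at h2
      exact h2.subset (preimage_mono subset_closure)
    obtain ⟨C, hC⟩ := hb.exists_norm_le
    have h3 := hC _ (hsub ⟨max 1 (C + 1), mem_Ici.2 (le_max_left _ _), rfl⟩)
    have h4 : (1 : ℝ) ≤ max 1 (C + 1) := le_max_left _ _
    have h5 : C + 1 ≤ max 1 (C + 1) := le_max_right _ _
    rw [norm_smul, Real.norm_of_nonneg (by linarith)] at h3
    nlinarith
  have hsub : V ⊆ Metric.ball 0 1 := by
    intro v hv
    rw [mem_ball_zero_iff]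
    refine lt_of_le_of_ne (not_lt.1 (hnot v hv)) fun h => ?_
    exact disjoint_left.1 hVd hv (mem_sphere_zero_iff_norm.2 h)
  refine hsub.antisymm ?_
  refine IsPreconnected.subset_of_disjoint_frontier (convex_ball _ _).isPreconnected hVo ?_ ?_
  · obtain ⟨v, hv⟩ := hVne
    exact ⟨v, hsub hv, hv⟩
  · rw [hVf, disjoint_left]
    intro x hx hx'
    rw [mem_ball_zero_iff] at hx
    rw [mem_sphere_zero_iff_norm] at hx'
    exact hx.ne hx'

open Real in
/-- The arcs of the circle starting at a given point, in either direction, and monotone in the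
distance to that point. -/
theorem exists_arc_param (θ₀ : ℝ) {w : Plane} (hw : w ∈ Metric.sphere (0 : Plane) 1) :
    ∃ c : ℝ → Plane, Continuous c ∧ (∀ v, c v ∈ Metric.sphere (0 : Plane) 1) ∧
      (∀ u ∈ Icc 0 π, ∀ v ∈ Icc 0 π, u ≤ v → dist (c u) (c 0) ≤ dist (c v) (c 0)) ∧
      c 0 = circlePt θ₀ ∧ c π = -circlePt θ₀ ∧ ∃ v ∈ Icc 0 π, c v = w := by
  obtain ⟨θ, rfl⟩ := sphere_eq_range_circlePt ▸ hw
  -- This representative is within `π` of `θ₀`, so the sign of `θ₁ - θ₀` tells in which direction a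
  -- half circle from `θ₀` reaches the point.
  obtain ⟨θ₁, hθ₁, hθ⟩ : ∃ θ₁ ∈ Ico (θ₀ - π) (θ₀ - π + 2 * π), circlePt θ₁ = circlePt θ := by
    have hp : Function.Periodic circlePt (2 * π) := circlePt_add_two_pi
    obtain ⟨y, hy, h⟩ := hp.exists_mem_Ico two_pi_pos θ (θ₀ - π)
    exact ⟨y, hy, h.symm⟩
  have hmem : ∀ x, circlePt x ∈ Metric.sphere (0 : Plane) 1 := fun x => by simp [norm_circlePt]
  have hsin : ∀ u ∈ Icc 0 π, ∀ v ∈ Icc 0 π, u ≤ v → |sin (u / 2)| ≤ |sin (v / 2)| := by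
    intro u hu v hv huv
    rw [abs_of_nonneg (sin_nonneg_of_nonneg_of_le_pi (by linarith [hu.1]) (by linarith [hu.1, hu.2])),
      abs_of_nonneg (sin_nonneg_of_nonneg_of_le_pi (by linarith [hv.1]) (by linarith [hv.1, hv.2]))]
    exact sin_le_sin_of_le_of_le_pi_div_two (by linarith [hu.1, pi_pos]) (by linarith [hv.2])
      (by linarith)
  have hcont := lipschitzWith_circlePt.continuous
  rcases le_total θ₀ θ₁ with h | h
  · refine ⟨fun v => circlePt (θ₀ + v), by fun_prop, fun v => hmem _, ?_, by simp,
      circlePt_add_pi _, θ₁ - θ₀, ⟨by linarith, by linarith [hθ₁.2]⟩, by simpa using hθ⟩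
    intro u hu v hv huv
    rw [dist_circlePt, dist_circlePt]
    simpa using hsin u hu v hv huv
  · refine ⟨fun v => circlePt (θ₀ - v), by fun_prop, fun v => hmem _, ?_, by simp,
      ?_, θ₀ - θ₁, ⟨by linarith, by linarith [hθ₁.1]⟩, by simpa using hθ⟩
    · intro u hu v hv huv
      rw [dist_circlePt, dist_circlePt]
      have := hsin u hu v hv huv
      simpa [neg_div] using this
    · have := circlePt_add_pi (θ₀ - π)
      rw [sub_add_cancel] at this
      simp [this]

section Quasicircle

variable {K : ℝ} {f : Plane ≃ₜ Plane}

open Real in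
/-- A quasidisk contains corkscrew points at all small scales. -/
theorem IsQuasiconformal.exists_corkscrew (hf : IsQuasiconformal K f) :
    ∃ c > 0, ∃ R₀ > 0, ∀ x ∈ f '' Metric.sphere 0 1, ∀ r ∈ Ioc 0 R₀,
      ∃ y ∈ f '' Metric.ball 0 1, dist y x = r ∧
        ∀ w ∈ f '' Metric.sphere 0 1, c * r ≤ dist y w := by
  have hK : 0 < K := zero_lt_one.trans_le hf.1
  set C := exp (18 * π ^ 2 * K) with hC
  have hC1 : 1 ≤ C := one_le_exp (by positivity)
  have hsc : IsCompact (Metric.sphere (0 : Plane) 1) := isCompact_sphere _ _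
  have hsne : (Metric.sphere (0 : Plane) 1).Nonempty := ⟨circlePt 0, by simp [norm_circlePt]⟩
  have hfc := f.continuous
  -- `m₀` and `m₁` are the least distances between the images of the two ends of a radius and of a
  -- diameter. Below these scales `f 0` and `f (-x)` count as far from `f x`.
  obtain ⟨p₀, hp₀, hmin₀⟩ := hsc.exists_isMinOn hsne (f := fun z => dist (f 0) (f z))
    (by fun_prop)
  obtain ⟨p₁, hp₁, hmin₁⟩ := hsc.exists_isMinOn hsne (f := fun z => dist (f (-z)) (f z))
    (by fun_prop)
  set m₀ := dist (f 0) (f p₀)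
  set m₁ := dist (f (-p₁)) (f p₁)
  have hm₀ : 0 < m₀ := by
    refine dist_pos.2 fun h => ?_
    rw [← f.injective h] at hp₀
    simp at hp₀
  have hm₁ : 0 < m₁ := by
    refine dist_pos.2 fun h => ?_
    have h2 := f.injective h
    have h3 : p₁ = 0 := by
      ext i
      have := congrArg (fun q : Plane => q i) h2
      simp only [PiLp.neg_apply] at this
      simp only [PiLp.zero_apply]
      linarith
    rw [h3] at hp₁
    simp at hp₁
  refine ⟨(2 * C)⁻¹, by positivity, min m₀ (m₁ / 2), by positivity, ?_⟩
  rintro _ ⟨x, hx, rfl⟩ r ⟨hr, hrR⟩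
  have hr₀ : r ≤ m₀ := hrR.trans (min_le_left _ _)
  have hr₁ : 2 * r ≤ m₁ := by linarith [hrR.trans (min_le_right m₀ (m₁ / 2))]
  obtain ⟨θ₀, rfl⟩ := sphere_eq_range_circlePt ▸ hx
  set x := circlePt θ₀
  have hx1 : ‖x‖ = 1 := norm_circlePt _
  -- The corkscrew point is found on the image of the radius through `x`, where its distance to `f
  -- x` first known to be attainable equals `r`.
  obtain ⟨t, ht, htr⟩ := intermediate_value_Icc (zero_le_one (α := ℝ))
    (f := fun t => dist (f ((1 - t) • x)) (f x)) (by fun_prop)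
    (show r ∈ _ by
      simp only [sub_zero, one_smul, dist_self, sub_self, zero_smul]
      exact ⟨hr.le, hr₀.trans (hmin₀ hx)⟩)
  simp only at htr
  have ht0 : 0 < t := by
    rcases ht.1.eq_or_lt with rfl | h
    · simp at htr; linarith
    · exact h
  have hyn : ‖(1 - t) • x‖ = 1 - t := by
    rw [norm_smul, hx1, mul_one, Real.norm_of_nonneg (by linarith [ht.2])]
  refine ⟨f ((1 - t) • x), ⟨_, ?_, rfl⟩, htr, ?_⟩
  · rw [mem_ball_zero_iff, hyn]; linarith
  rintro _ ⟨w, hw, rfl⟩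
  -- If the image of some boundary point `w` were too close, there would be two separated connected
  -- sets whose images both run from distance at most `η` to distance at least `r/2` from `f w`; the
  -- distortion estimate then forces `r/2 ≤ C η`.
  by_contra! hlt
  set η := dist (f ((1 - t) • x)) (f w) with hη
  have hη0 : 0 < η := by
    refine dist_pos.2 fun h => ?_
    rw [← f.injective h, mem_sphere_zero_iff_norm, hyn] at hw
    linarith
  have hCη : C * η < r / 2 := by
    have := mul_lt_mul_of_pos_left hlt (show 0 < 2 * C by positivity)
    rw [← mul_assoc, mul_inv_cancel₀ (by positivity), one_mul] at this
    linarith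
  have hηr : η ≤ r / 2 := (le_mul_of_one_le_left hη0.le hC1).trans hCη.le
  have hxw : r / 2 ≤ dist (f x) (f w) := by
    have := dist_triangle_right (f ((1 - t) • x)) (f x) (f w)
    linarith
  have hxw' : dist (f x) (f w) ≤ r + η := by
    have := dist_triangle_left (f x) (f w) (f ((1 - t) • x))
    linarith
  refine absurd hCη (not_lt.2 ?_)
  obtain ⟨c, hc, hcs, hcmono, hc0, hcπ, v, hv, rfl⟩ := exists_arc_param θ₀ hw
  have hpre : ∀ a b, IsPreconnected (c '' Icc a b) :=
    fun a b => isPreconnected_Icc.image _ hc.continuousOn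
  have hpreE : ∀ a b, IsPreconnected ((fun s : ℝ => (1 - s) • x) '' Icc a b) :=
    fun a b => isPreconnected_Icc.image _ (by fun_prop)
  have hwη : dist (f (c v)) (f (c v)) ≤ η := by rw [dist_self]; exact hη0.le
  have hc0' : c 0 = x := hc0
  -- If `w` is at least `2t` from `x`, the sets are the radial segment from `x` to `(1 - t)x` and
  -- the boundary arc from `w` to `-x`. Otherwise they are the boundary arc from `x` to `w` and the
  -- radial segment from `(1 - t)x` to the center. In both cases they are `t` apart.
  rcases le_total (2 * t) (dist (c v) x) with h | h
  · refine hf.annulus_le (hpreE 0 t) (hpre v π) (m := x) (ρ := t) (b := t) (w := f (c v)) ht0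
      (by linarith) ?_ ?_ hη0 ?_ ?_
    · rintro _ ⟨s, hs, rfl⟩
      rw [Metric.mem_closedBall, dist_eq_norm]
      have : (1 - s) • x - x = -(s • x) := by rw [sub_smul, one_smul]; abel
      rw [this, norm_neg, norm_smul, hx1, mul_one, Real.norm_of_nonneg hs.1]
      exact hs.2
    · rintro _ ⟨s, hs, rfl⟩ _ ⟨u, hu, rfl⟩
      have h1 := hcmono v hv u ⟨hv.1.trans hu.1, hu.2⟩ hu.1
      rw [hc0'] at h1
      have h2 : dist ((1 - s) • x) x ≤ t := by
        rw [dist_eq_norm]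
        have : (1 - s) • x - x = -(s • x) := by rw [sub_smul, one_smul]; abel
        rw [this, norm_neg, norm_smul, hx1, mul_one, Real.norm_of_nonneg hs.1]
        exact hs.2
      have := dist_triangle_left (c u) x ((1 - s) • x)
      linarith
    · exact ⟨⟨_, ⟨_, ⟨t, right_mem_Icc.2 ht0.le, rfl⟩, rfl⟩, le_rfl⟩,
        ⟨_, ⟨_, ⟨0, left_mem_Icc.2 ht0.le, rfl⟩, rfl⟩, by simpa using hxw⟩⟩
    · refine ⟨⟨_, ⟨_, ⟨v, left_mem_Icc.2 hv.2, rfl⟩, rfl⟩, hwη⟩,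
        ⟨_, ⟨_, ⟨π, right_mem_Icc.2 hv.2, rfl⟩, rfl⟩, ?_⟩⟩
      rw [hcπ]
      have h1 : m₁ ≤ dist (f (-x)) (f x) := hmin₁ hx
      have h2 := dist_triangle_right (f (-x)) (f x) (f (c v))
      change r / 2 ≤ dist (f (-x)) (f (c v))
      linarith
  · refine hf.annulus_le (hpre 0 v) (hpreE t 1) (m := x) (ρ := 2 * t) (b := t) (w := f (c v)) ht0
      le_rfl ?_ ?_ hη0 ?_ ?_
    · rintro _ ⟨u, hu, rfl⟩
      have h1 := hcmono u ⟨hu.1, hu.2.trans hv.2⟩ v hv hu.2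
      rw [hc0'] at h1
      exact h1.trans h
    · rintro _ ⟨u, hu, rfl⟩ _ ⟨s, hs, rfl⟩
      have h1 : ‖c u‖ = 1 := mem_sphere_zero_iff_norm.1 (hcs u)
      have h2 : ‖(1 - s) • x‖ = 1 - s := by
        rw [norm_smul, hx1, mul_one, Real.norm_of_nonneg (by linarith [hs.2])]
      have h3 := norm_sub_norm_le (c u) ((1 - s) • x)
      rw [← dist_eq_norm] at h3
      linarith [hs.1]
    · exact ⟨⟨_, ⟨_, ⟨v, right_mem_Icc.2 hv.1, rfl⟩, rfl⟩, hwη⟩,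
        ⟨_, ⟨_, ⟨0, left_mem_Icc.2 hv.1, rfl⟩, rfl⟩, by rw [hc0']; exact hxw⟩⟩
    · refine ⟨⟨_, ⟨_, ⟨t, left_mem_Icc.2 ht.2, rfl⟩, rfl⟩, le_rfl⟩,
        ⟨_, ⟨_, ⟨1, right_mem_Icc.2 ht.2, rfl⟩, rfl⟩, ?_⟩⟩
      have : m₀ ≤ dist (f 0) (f (c v)) := hmin₀ hw
      simp only [sub_self, zero_smul]
      linarith

end Quasicircle

/-! ### Covering a small piece of a quasicircle by two subarcs. -/

theorem exists_maximal_initial_arc {h : ℝ → Plane} (hh : Continuous h) {L D : ℝ} (hL : 0 < L)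
    (hD : 0 < D) : ∃ T ∈ Ioc 0 L, (∀ u ∈ Icc 0 T, dist (h u) (h 0) ≤ D) ∧
      ∀ b ∈ Icc 0 L, (∀ u ∈ Icc 0 b, dist (h u) (h 0) ≤ D) → b ≤ T := by
  set S := {b | b ∈ Icc 0 L ∧ ∀ u ∈ Icc 0 b, dist (h u) (h 0) ≤ D} with hS
  have hbdd : BddAbove S := ⟨L, fun b hb => hb.1.2⟩
  have hle : ∀ b ∈ S, b ≤ sSup S := fun b hb => le_csSup hbdd hb
  obtain ⟨δ, hδ, hδD⟩ := Metric.continuous_iff.1 hh 0 D hD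
  have hmem : min (δ / 2) L ∈ S := by
    refine ⟨⟨by positivity, min_le_right _ _⟩, fun u hu => (hδD u ?_).le⟩
    rw [Real.dist_0_eq_abs, abs_of_nonneg hu.1]
    linarith [hu.2.trans (min_le_left _ _)]
  have hpos : 0 < sSup S := lt_of_lt_of_le (by positivity) (hle _ hmem)
  refine ⟨sSup S, ⟨hpos, csSup_le ⟨_, hmem⟩ fun b hb => hb.1.2⟩, ?_, fun b hb hb' => hle b ⟨hb, hb'⟩⟩
  have hlt : Ico 0 (sSup S) ⊆ {u | dist (h u) (h 0) ≤ D} := by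
    intro u hu
    obtain ⟨b, hb, hub⟩ := exists_lt_of_lt_csSup ⟨_, hmem⟩ hu.2
    exact hb.2 u ⟨hu.1, hub.le⟩
  have hcl : IsClosed {u | dist (h u) (h 0) ≤ D} := isClosed_le (by fun_prop) continuous_const
  have := hcl.closure_subset_iff.2 hlt
  rwa [closure_Ico hpos.ne] at this

open Real in
theorem injOn_circlePt (a : ℝ) : InjOn circlePt (Ico a (a + 2 * π)) := by
  intro x hx y hy hxy
  by_contra hne
  wlog hlt : x < y generalizing x y
  · exact this hy hx hxy.symm (Ne.symm hne) (lt_of_le_of_ne (not_lt.1 hlt) (Ne.symm hne))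
  have h1 := le_dist_circlePt (x := x) (y := y) (l := min (y - x) (2 * π - (y - x)))
    (le_min (by linarith) (by linarith [hx.1, hy.2])) (min_le_left _ _)
    (by linarith [min_le_right (y - x) (2 * π - (y - x))])
  rw [hxy, dist_self] at h1
  have h2 : 0 < min (y - x) (2 * π - (y - x)) := lt_min (by linarith) (by linarith [hx.1, hy.2])
  have : 0 < 2 * min (y - x) (2 * π - (y - x)) / π := by positivity
  linarith

open Real in
theorem isSubarc_image {f : Plane ≃ₜ Plane} {a b : ℝ} (hab : a < b) (hb : b < a + 2 * π) :
    IsSubarc (f '' (circlePt '' Icc a b)) (f '' Metric.sphere 0 1) := by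
  constructor
  · refine ⟨_, _, fun t => f (circlePt (a + t * (b - a))), ?_, ?_, rfl, rfl, ?_⟩
    · have h1 := f.continuous
      have h2 := lipschitzWith_circlePt.continuous
      fun_prop
    · intro s t hst
      have hmem : ∀ s : unitInterval, a + s * (b - a) ∈ Ico a (a + 2 * π) := by
        intro s
        have h1 := s.2.1
        have h2 := s.2.2
        constructor <;> nlinarith
      have := injOn_circlePt a (hmem s) (hmem t) (f.injective hst)
      have hba : b - a ≠ 0 := (sub_pos.2 hab).ne'
      exact Subtype.ext (mul_right_cancel₀ hba (add_left_cancel this))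
    · ext x
      simp only [mem_range, mem_image]
      constructor
      · rintro ⟨t, rfl⟩
        have h1 := t.2.1
        have h2 := t.2.2
        exact ⟨_, ⟨_, ⟨by nlinarith, by nlinarith⟩, rfl⟩, rfl⟩
      · rintro ⟨_, ⟨θ, hθ, rfl⟩, rfl⟩
        have hba : 0 < b - a := sub_pos.2 hab
        refine ⟨⟨(θ - a) / (b - a), by have := hθ.1; have : 0 ≤ θ - a := by linarith
                                       positivity, ?_⟩, ?_⟩
        · rw [div_le_one hba]; linarith [hθ.2]
        · simp only
          rw [div_mul_cancel₀ _ hba.ne', add_sub_cancel]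
  · refine image_mono ?_
    rw [sphere_eq_range_circlePt]
    exact image_subset_range _ _

/-- `A` is the longest arc starting at `f (circlePt a)` in direction `σ` that stays within `D` of
its start; it contains each point reached by such an arc. The diameter hypothesis prevents it from
closing up, so that it is a genuine subarc. -/
theorem exists_arc_diam_le {f : Plane ≃ₜ Plane} {D : ℝ} (hD : 0 < D) (a σ : ℝ) (hσ : σ = 1 ∨ σ = -1)
    (hdiam : ∃ p ∈ f '' Metric.sphere 0 1, ∃ q ∈ f '' Metric.sphere 0 1, 2 * D < dist p q) :
    ∃ A, IsSubarc A (f '' Metric.sphere 0 1) ∧ Metric.diam A ≤ 2 * D ∧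
      ∀ b ∈ Icc 0 (2 * Real.pi),
        (∀ u ∈ Icc 0 b, dist (f (circlePt (a + σ * u))) (f (circlePt a)) ≤ D) →
        f (circlePt (a + σ * b)) ∈ A := by
  have h1 := f.continuous
  have h2 := lipschitzWith_circlePt.continuous
  obtain ⟨T, hT, hTD, hTmax⟩ := exists_maximal_initial_arc
    (h := fun u => f (circlePt (a + σ * u))) (by fun_prop) Real.two_pi_pos hD
  simp only [mul_zero, add_zero] at hTD hTmax
  have hTlt : T < 2 * Real.pi := by
    refine lt_of_le_of_ne hT.2 fun hTe => ?_
    have hall : ∀ p ∈ f '' Metric.sphere 0 1, dist p (f (circlePt a)) ≤ D := by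
      rintro _ ⟨x, hx, rfl⟩
      obtain ⟨θ, rfl⟩ := sphere_eq_range_circlePt ▸ hx
      have hp : Function.Periodic (fun u => circlePt (a + σ * u)) (2 * Real.pi) := by
        intro u
        rcases hσ with rfl | rfl
        · simp only [one_mul, ← add_assoc, circlePt_add_two_pi]
        · simp only
          rw [← circlePt_add_two_pi]
          congr 1
          ring
      obtain ⟨y, hy, hye⟩ := hp.exists_mem_Ico₀ Real.two_pi_pos (σ * (θ - a))
      have hσ2 : a + σ * (σ * (θ - a)) = θ := by
        rcases hσ with rfl | rfl <;> ring
      simp only [hσ2] at hye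
      rw [hye]
      exact hTD y ⟨hy.1, hy.2.le.trans hTe.ge⟩
    obtain ⟨p, hp, q, hq, hpq⟩ := hdiam
    have := dist_triangle_right p q (f (circlePt a))
    linarith [hall p hp, hall q hq]
  have hset : (fun u => a + σ * u) '' Icc 0 T = if σ = 1 then Icc a (a + T) else Icc (a - T) a := by
    rcases hσ with rfl | rfl
    · simp [add_comm]
    · rw [if_neg (by norm_num)]
      have : (fun u : ℝ => a + -1 * u) = fun u => a - u := by ext; ring
      rw [this]
      simp
  refine ⟨f '' (circlePt '' ((fun u => a + σ * u) '' Icc 0 T)), ?_, ?_, ?_⟩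
  · rw [hset]
    split_ifs
    · exact isSubarc_image (by linarith [hT.1]) (by linarith)
    · exact isSubarc_image (by linarith [hT.1]) (by linarith)
  · refine Metric.diam_le_of_forall_dist_le (by positivity) ?_
    rintro _ ⟨_, ⟨_, ⟨u, hu, rfl⟩, rfl⟩, rfl⟩ _ ⟨_, ⟨_, ⟨v, hv, rfl⟩, rfl⟩, rfl⟩
    refine (dist_triangle_right _ _ (f (circlePt a))).trans ?_
    linarith [hTD u hu, hTD v hv]
  · intro b hb hbD
    exact ⟨_, ⟨_, ⟨b, ⟨hb.1, hTmax b hb hbD⟩, rfl⟩, rfl⟩, rfl⟩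

open Real in
/-- The part of a quasicircle in a small disk is contained in two small subarcs. -/
theorem IsQuasiconformal.exists_subarcs {K : ℝ} {f : Plane ≃ₜ Plane} (hf : IsQuasiconformal K f) :
    ∃ C ≥ 1, ∃ R₀ > 0, ∀ x : Plane, ∀ r ∈ Ioc 0 R₀, ∃ A₁ A₂,
      IsSubarc A₁ (f '' Metric.sphere 0 1) ∧ IsSubarc A₂ (f '' Metric.sphere 0 1) ∧
      Metric.diam A₁ ≤ C * r ∧ Metric.diam A₂ ≤ C * r ∧
      f '' Metric.sphere 0 1 ∩ Metric.closedBall x r ⊆ A₁ ∪ A₂ := by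
  have hK : 0 < K := zero_lt_one.trans_le hf.1
  set C := exp (18 * π ^ 2 * K) with hC
  have hC1 : 1 ≤ C := one_le_exp (by positivity)
  have hmem : ∀ θ, f (circlePt θ) ∈ f '' Metric.sphere 0 1 :=
    fun θ => ⟨_, by simp [norm_circlePt], rfl⟩
  have hd : 0 < dist (f (circlePt 0)) (f (circlePt π)) := by
    refine dist_pos.2 fun h => ?_
    have h1 := congrArg (fun x : Plane => x 0) (f.injective h)
    norm_num [circlePt] at h1
  refine ⟨4 * C, by linarith, dist (f (circlePt 0)) (f (circlePt π)) / (8 * C), by positivity, ?_⟩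
  intro x r ⟨hr, hrR⟩
  have hD : 0 < C * (2 * r) := by positivity
  have hdiam : ∃ p ∈ f '' Metric.sphere 0 1, ∃ q ∈ f '' Metric.sphere 0 1,
      2 * (C * (2 * r)) < dist p q := by
    refine ⟨_, hmem 0, _, hmem π, ?_⟩
    rw [le_div_iff₀ (by positivity)] at hrR
    nlinarith
  obtain ⟨a, ha⟩ : ∃ a, ∀ p ∈ f '' Metric.sphere 0 1 ∩ Metric.closedBall x r,
      dist p (f (circlePt a)) ≤ 2 * r := by
    rcases (f '' Metric.sphere 0 1 ∩ Metric.closedBall x r).eq_empty_or_nonempty with h | ⟨q, hq⟩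
    · exact ⟨0, by simp [h]⟩
    · obtain ⟨⟨y, hy, rfl⟩, hq2⟩ := hq
      obtain ⟨a, rfl⟩ := sphere_eq_range_circlePt ▸ hy
      refine ⟨a, fun p hp => ?_⟩
      have h1 : dist p x ≤ r := hp.2
      have h2 : dist (f (circlePt a)) x ≤ r := hq2
      linarith [dist_triangle_right p (f (circlePt a)) x]
  obtain ⟨A₁, hA₁, hd₁, hm₁⟩ := exists_arc_diam_le hD a 1 (Or.inl rfl) hdiam
  obtain ⟨A₂, hA₂, hd₂, hm₂⟩ := exists_arc_diam_le hD a (-1) (Or.inr rfl) hdiam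
  refine ⟨A₁, A₂, hA₁, hA₂, by linarith, by linarith, ?_⟩
  intro p hp
  have hpa := ha p hp
  obtain ⟨⟨y, hy, rfl⟩, -⟩ := hp
  obtain ⟨θ, rfl⟩ := sphere_eq_range_circlePt ▸ hy
  have hper : Function.Periodic circlePt (2 * π) := circlePt_add_two_pi
  obtain ⟨b, hb, hbe⟩ := hper.exists_mem_Ico Real.two_pi_pos θ a
  rw [hbe] at hpa ⊢
  -- Bounded turning keeps one of the two arcs between the base point and the given point close to
  -- the base point; its direction decides between `A₁` and `A₂`.
  rcases hf.bounded_turning (by positivity) hpa with h | h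
  · left
    have := hm₁ (b - a) ⟨by linarith [hb.1], by linarith [hb.2]⟩ fun u hu =>
      h _ ⟨by linarith [hu.1], by linarith [hu.2]⟩
    simpa using this
  · right
    have := hm₂ (a + 2 * π - b) ⟨by linarith [hb.2], by linarith [hb.1]⟩ fun u hu => by
      have := h (a + -1 * u + 2 * π) ⟨by linarith [hu.2], by linarith [hu.1]⟩
      rwa [circlePt_add_two_pi] at this
    rw [← circlePt_add_two_pi] at this
    ring_nf at this
    exact this

/-! ### Iterated partitions and covering numbers. -/

theorem IsArc.isPreconnected {A : Set Plane} (hA : IsArc A) : IsPreconnected A := by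
  obtain ⟨p, q, c, hc, -, -, -, rfl⟩ := hA
  exact isPreconnected_range hc

theorem IsArc.isCompact {A : Set Plane} (hA : IsArc A) : IsCompact A := by
  obtain ⟨p, q, c, hc, -, -, -, rfl⟩ := hA
  exact isCompact_range hc

theorem IsArc.diam_pos {A : Set Plane} (hA : IsArc A) : 0 < Metric.diam A := by
  have hb := hA.isCompact.isBounded
  obtain ⟨p, q, c, hc, hi, -, -, rfl⟩ := hA
  refine (dist_pos.2 (hi.ne zero_ne_one)).trans_le
    (Metric.dist_le_diam_of_mem hb (mem_range_self _) (mem_range_self _))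

theorem sum_biUnion_le_sum_sum {ι κ : Type*} [DecidableEq κ] (s : Finset ι) (t : ι → Finset κ)
    {f : κ → ℝ} (hf : ∀ x, 0 ≤ f x) : ∑ x ∈ s.biUnion t, f x ≤ ∑ i ∈ s, ∑ x ∈ t i, f x := by
  classical
  induction s using Finset.induction_on with
  | empty => simp
  | insert i s hi ih =>
    rw [Finset.biUnion_insert, Finset.sum_insert hi]
    have h1 := Finset.sum_union_inter (s₁ := t i) (s₂ := s.biUnion t) (f := f)
    have h2 : 0 ≤ ∑ x ∈ t i ∩ s.biUnion t, f x := Finset.sum_nonneg fun x _ => hf x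
    linarith

/-- Iterating the weak chord-arc property. -/
theorem exists_iterated_partition {Γ : Set Plane} {M : ℝ} (hM : 0 ≤ M)
    (h : ∀ A : Set Plane, IsSubarc A Γ → Metric.diam A < 1 →
      ∃ P : Finset (Set Plane), IsDeltaPartition (Metric.diam A) A P ∧ chordArcIndex A P ≤ M)
    (k : ℕ) : ∀ {A : Set Plane} {D : ℝ}, IsSubarc A Γ → Metric.diam A ≤ D → D < 1 →
      ∃ P : Finset (Set Plane), (∀ B ∈ P, Bornology.IsBounded B ∧ Metric.diam B ≤ D ^ (2 ^ k)) ∧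
        A ⊆ ⋃ B ∈ P, B ∧ ∑ B ∈ P, Metric.diam B ≤ M ^ k * Metric.diam A := by
  classical
  induction k with
  | zero =>
    intro A D hA hAD _
    refine ⟨{A}, ?_, by simp, by simp⟩
    simpa using ⟨hA.1.isCompact.isBounded, hAD⟩
  | succ k ih =>
    intro A D hA hAD hD
    obtain ⟨P, ⟨hP, hPd⟩, hPM⟩ := h A hA (hAD.trans_lt hD)
    have hd := hA.1.diam_pos
    have hsub : ∀ B ∈ P, IsSubarc B Γ := fun B hB =>
      ⟨(hP.isSubarc B hB).1, (hP.isSubarc B hB).2.trans hA.2⟩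
    -- Since `δ` is the diameter itself, pieces of `A` have diameter at most its square; this is the
    -- source of the exponent `2 ^ k`, while the total diameter grows only by a factor `M` per step.
    have hBD : ∀ B ∈ P, Metric.diam B ≤ D ^ 2 := fun B hB => (hPd B hB).2.trans (by nlinarith)
    have hD0 : 0 ≤ D := hd.le.trans hAD
    have key : ∀ B ∈ P, ∃ Q : Finset (Set Plane),
        (∀ B' ∈ Q, Bornology.IsBounded B' ∧ Metric.diam B' ≤ (D ^ 2) ^ (2 ^ k)) ∧
        B ⊆ ⋃ B' ∈ Q, B' ∧ ∑ B' ∈ Q, Metric.diam B' ≤ M ^ k * Metric.diam B :=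
      fun B hB => ih (hsub B hB) (hBD B hB) (by nlinarith)
    choose! Q hQ₁ hQ₂ hQ₃ using key
    refine ⟨P.biUnion Q, ?_, ?_, ?_⟩
    · intro B' hB'
      obtain ⟨B, hB, hBB'⟩ := Finset.mem_biUnion.1 hB'
      have := hQ₁ B hB B' hBB'
      rwa [← pow_mul, ← pow_succ'] at this
    · intro x hx
      rw [← hP.iUnion_eq] at hx
      obtain ⟨B, hB, hxB⟩ := mem_iUnion₂.1 hx
      obtain ⟨B', hB', hxB'⟩ := mem_iUnion₂.1 (hQ₂ B hB hxB)
      exact mem_iUnion₂.2 ⟨B', Finset.mem_biUnion.2 ⟨B, hB, hB'⟩, hxB'⟩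
    · calc ∑ B' ∈ P.biUnion Q, Metric.diam B' ≤ ∑ B ∈ P, ∑ B' ∈ Q B, Metric.diam B' := by
            exact sum_biUnion_le_sum_sum P Q fun _ => Metric.diam_nonneg
        _ ≤ ∑ B ∈ P, M ^ k * Metric.diam B := Finset.sum_le_sum hQ₃
        _ = M ^ k * ∑ B ∈ P, Metric.diam B := by rw [Finset.mul_sum]
        _ ≤ M ^ k * (M * Metric.diam A) := by
            gcongr
            rw [chordArcIndex, one_div_mul_eq_div, div_le_iff₀ hd] at hPM
            exact hPM
        _ = _ := by ring

/-- Since `A` is connected and contains a second point at distance at least `t`, it crosses the ball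
of radius `t/4` around each `z`, so the pieces meeting this ball have total diameter at least `t/4`.
A piece of diameter at most `t/2` cannot meet two of these balls, so the contributions add up. -/
theorem card_mul_le_of_separated {A : Set Plane} (hA : IsPreconnected A) {P : Finset (Set Plane)}
    {t S : ℝ} (ht : 0 < t)
    (hP : ∀ B ∈ P, Bornology.IsBounded B ∧ Metric.diam B ≤ t / 2) (hAP : A ⊆ ⋃ B ∈ P, B)
    (hS : ∑ B ∈ P, Metric.diam B ≤ S) {Z : Finset Plane} (hZA : ∀ z ∈ Z, z ∈ A)
    (hZ : ∀ z ∈ Z, ∀ z' ∈ Z, z ≠ z' → t ≤ dist z z') (hcard : 2 ≤ Z.card) :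
    Z.card * (t / 4) ≤ S := by
  classical
  let Q : Plane → Finset (Set Plane) := fun z => P.filter fun B => (B ∩ Metric.ball z (t / 4)).Nonempty
  have hdisj : (Z : Set Plane).PairwiseDisjoint Q := by
    intro z hz z' hz' hne
    refine Finset.disjoint_left.2 fun B hB hB' => ?_
    obtain ⟨hBP, x, hx, hxz⟩ := Finset.mem_filter.1 hB
    obtain ⟨-, x', hx', hxz'⟩ := Finset.mem_filter.1 hB'
    have h1 := Metric.dist_le_diam_of_mem (hP B hBP).1 hx hx'
    have h2 := (hP B hBP).2
    have h3 := hZ z hz z' hz' hne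
    have h4 : dist x z < t / 4 := hxz
    have h5 : dist x' z' < t / 4 := hxz'
    linarith [dist_triangle4_left x x' z z']
  have hQ : ∀ z ∈ Z, t / 4 ≤ ∑ B ∈ Q z, Metric.diam B := by
    intro z hz
    obtain ⟨z', hz', hne⟩ := Finset.exists_mem_ne hcard z
    have hiv := hA.intermediate_value (hZA z hz) (hZA z' hz') (f := fun x => dist x z) (by fun_prop)
    simp only [dist_self] at hiv
    have hle : t ≤ dist z' z := hZ z' hz' z hz hne
    have hcov : Ico 0 (t / 4) ⊆ ⋃ B ∈ Q z, (fun x => dist x z) '' B := by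
      intro s hs
      obtain ⟨x, hxA, hxs⟩ := hiv ⟨hs.1, by linarith [hs.2]⟩
      obtain ⟨B, hB, hxB⟩ := mem_iUnion₂.1 (hAP hxA)
      refine mem_iUnion₂.2 ⟨B, Finset.mem_filter.2 ⟨hB, x, hxB, ?_⟩, x, hxB, hxs⟩
      rw [Metric.mem_ball]
      exact hxs.trans_lt hs.2
    have hvol : ENNReal.ofReal (t / 4) ≤ ∑ B ∈ Q z, ENNReal.ofReal (Metric.diam B) := by
      calc ENNReal.ofReal (t / 4) = volume (Ico 0 (t / 4)) := by rw [Real.volume_Ico, sub_zero]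
        _ ≤ volume (⋃ B ∈ Q z, (fun x => dist x z) '' B) := measure_mono hcov
        _ ≤ ∑ B ∈ Q z, volume ((fun x => dist x z) '' B) := measure_biUnion_finset_le _ _
        _ ≤ _ := by
          refine Finset.sum_le_sum fun B hB => ?_
          have hBP := (Finset.mem_filter.1 hB).1
          refine (Real.volume_le_diam _).trans ?_
          have hlip : LipschitzWith 1 fun x : Plane => dist x z := LipschitzWith.dist_left z
          have := hlip.ediam_image_le B
          rw [ENNReal.coe_one, one_mul] at this
          refine this.trans ?_
          rw [Metric.diam, ENNReal.ofReal_toReal]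
          exact (hP B hBP).1.ediam_ne_top
    rw [← ENNReal.ofReal_sum_of_nonneg fun _ _ => Metric.diam_nonneg,
      ENNReal.ofReal_le_ofReal_iff (Finset.sum_nonneg fun _ _ => Metric.diam_nonneg)] at hvol
    exact hvol
  calc Z.card * (t / 4) = ∑ z ∈ Z, t / 4 := by rw [Finset.sum_const, nsmul_eq_mul]
    _ ≤ ∑ z ∈ Z, ∑ B ∈ Q z, Metric.diam B := Finset.sum_le_sum hQ
    _ = ∑ B ∈ Z.biUnion Q, Metric.diam B := (Finset.sum_biUnion hdisj).symm
    _ ≤ ∑ B ∈ P, Metric.diam B := by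
        refine Finset.sum_le_sum_of_subset_of_nonneg ?_ fun _ _ _ => Metric.diam_nonneg
        exact Finset.biUnion_subset.2 fun z _ => Finset.filter_subset _ _
    _ ≤ S := hS

/-- A `t`-separated subset of maximal cardinality is a `t`-net. The summand 1 accounts for sets with
at most one point, which the counting estimate does not cover. -/
theorem exists_cover_of_partition {A : Set Plane} (hA : IsPreconnected A) {P : Finset (Set Plane)}
    {t S : ℝ} (ht : 0 < t)
    (hP : ∀ B ∈ P, Bornology.IsBounded B ∧ Metric.diam B ≤ t / 2) (hAP : A ⊆ ⋃ B ∈ P, B)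
    (hS : ∑ B ∈ P, Metric.diam B ≤ S) :
    ∃ Z : Finset Plane, A ⊆ ⋃ z ∈ Z, Metric.ball z t ∧ (Z.card : ℝ) ≤ 4 * S / t + 1 := by
  classical
  have hS0 : 0 ≤ S := (Finset.sum_nonneg fun _ _ => Metric.diam_nonneg).trans hS
  let 𝒵 : Set (Finset Plane) :=
    {Z | (∀ z ∈ Z, z ∈ A) ∧ ∀ z ∈ Z, ∀ z' ∈ Z, z ≠ z' → t ≤ dist z z'}
  have hbound : ∀ Z ∈ 𝒵, (Z.card : ℝ) ≤ 4 * S / t + 1 := by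
    intro Z hZ
    rcases lt_or_ge Z.card 2 with h | h
    · have : (Z.card : ℝ) ≤ 1 := by exact_mod_cast Nat.lt_succ_iff.1 h
      have : 0 ≤ 4 * S / t := by positivity
      linarith
    · have := card_mul_le_of_separated hA ht hP hAP hS hZ.1 hZ.2 h
      have h2 : (Z.card : ℝ) ≤ 4 * S / t := by
        rw [le_div_iff₀ ht]; linarith
      linarith
  have hne : (Finset.card '' 𝒵).Nonempty := ⟨_, ∅, by simp [𝒵], rfl⟩
  have hbdd : BddAbove (Finset.card '' 𝒵) := by
    refine ⟨⌈4 * S / t + 1⌉₊, ?_⟩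
    rintro _ ⟨Z, hZ, rfl⟩
    exact_mod_cast (hbound Z hZ).trans (Nat.le_ceil _)
  obtain ⟨Z, hZ, hZmax⟩ := Nat.sSup_mem hne hbdd
  refine ⟨Z, fun x hx => ?_, hbound Z hZ⟩
  by_contra hcon
  have hfar : ∀ z ∈ Z, t ≤ dist x z := by
    intro z hz
    by_contra! hlt
    exact hcon (mem_iUnion₂.2 ⟨z, hz, hlt⟩)
  have hxZ : x ∉ Z := fun h => by
    have := hfar x h
    rw [dist_self] at this
    linarith
  have hins : insert x Z ∈ 𝒵 := by
    refine ⟨fun z hz => ?_, fun z hz z' hz' hzz => ?_⟩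
    · rcases Finset.mem_insert.1 hz with rfl | h
      exacts [hx, hZ.1 z h]
    · rcases Finset.mem_insert.1 hz with rfl | h <;> rcases Finset.mem_insert.1 hz' with rfl | h'
      · exact absurd rfl hzz
      · exact hfar _ h'
      · rw [dist_comm]; exact hfar _ h
      · exact hZ.2 z h z' h' hzz
  have := le_csSup hbdd ⟨_, hins, rfl⟩
  rw [Finset.card_insert_of_notMem hxZ, ← hZmax] at this
  omega

/-- Covering numbers of a quasicircle with the weak chord-arc property. -/
theorem exists_cover_quasicircle {K : ℝ} {f : Plane ≃ₜ Plane} (hf : IsQuasiconformal K f)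
    (hW : IsWeakChordArc (f '' Metric.sphere 0 1)) :
    ∃ C ≥ 1, ∃ R₀ > 0, ∃ M ≥ (1 : ℝ), C * R₀ < 1 ∧ ∀ x : Plane, ∀ r ∈ Ioc 0 R₀, ∀ k : ℕ, ∀ t > 0,
      (C * r) ^ (2 ^ k) ≤ t / 2 → ∃ Z : Finset Plane,
        f '' Metric.sphere 0 1 ∩ Metric.closedBall x r ⊆ ⋃ z ∈ Z, Metric.ball z t ∧
        (Z.card : ℝ) ≤ 8 * (M ^ k * (C * r)) / t + 2 := by
  classical
  obtain ⟨C, hC, R₀, hR₀, h⟩ := hf.exists_subarcs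
  obtain ⟨M, hM, hW⟩ := hW
  have hW' : ∀ A : Set Plane, IsSubarc A (f '' Metric.sphere 0 1) → Metric.diam A < 1 →
      ∃ P : Finset (Set Plane), IsDeltaPartition (Metric.diam A) A P ∧
        chordArcIndex A P ≤ max M 1 := fun A hA hd =>
    let ⟨P, hP, hPM⟩ := hW A hA hd
    ⟨P, hP, hPM.trans (le_max_left _ _)⟩
  have hM0 : 0 ≤ max M 1 := zero_le_one.trans (le_max_right _ _)
  refine ⟨C, hC, min R₀ (1 / (2 * C)), by positivity, max M 1, le_max_right _ _, ?_, ?_⟩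
  · calc C * min R₀ (1 / (2 * C)) ≤ C * (1 / (2 * C)) := by gcongr; exact min_le_right _ _
      _ < 1 := by field_simp; norm_num
  rintro x r ⟨hr, hrR⟩ k t ht hkt
  have hCr : C * r < 1 := by
    calc C * r ≤ C * (1 / (2 * C)) := by gcongr; exact hrR.trans (min_le_right _ _)
      _ < 1 := by field_simp; norm_num
  obtain ⟨A₁, A₂, hA₁, hA₂, hd₁, hd₂, hsub⟩ := h x r ⟨hr, hrR.trans (min_le_left _ _)⟩
  have key : ∀ A, IsSubarc A (f '' Metric.sphere 0 1) → Metric.diam A ≤ C * r →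
      ∃ Z : Finset Plane, A ⊆ ⋃ z ∈ Z, Metric.ball z t ∧
        (Z.card : ℝ) ≤ 4 * (max M 1 ^ k * (C * r)) / t + 1 := by
    intro A hA hd
    obtain ⟨P, hP₁, hP₂, hP₃⟩ := exists_iterated_partition hM0 hW' k hA hd hCr
    exact exists_cover_of_partition hA.1.isPreconnected ht
      (fun B hB => ⟨(hP₁ B hB).1, (hP₁ B hB).2.trans hkt⟩) hP₂ (hP₃.trans (by gcongr))
  obtain ⟨Z₁, hZ₁, hc₁⟩ := key A₁ hA₁ hd₁
  obtain ⟨Z₂, hZ₂, hc₂⟩ := key A₂ hA₂ hd₂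
  refine ⟨Z₁ ∪ Z₂, fun p hp => ?_, ?_⟩
  · rcases hsub hp with h | h
    · obtain ⟨z, hz, hpz⟩ := mem_iUnion₂.1 (hZ₁ h)
      exact mem_iUnion₂.2 ⟨z, Finset.mem_union_left _ hz, hpz⟩
    · obtain ⟨z, hz, hpz⟩ := mem_iUnion₂.1 (hZ₂ h)
      exact mem_iUnion₂.2 ⟨z, Finset.mem_union_right _ hz, hpz⟩
  · have : ((Z₁ ∪ Z₂).card : ℝ) ≤ Z₁.card + Z₂.card := by exact_mod_cast Finset.card_union_le _ _
    refine this.trans ((add_le_add hc₁ hc₂).trans (le_of_eq ?_))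
    ring

/-! ### The graph over a shell: control of the missing coordinate. -/

/-- The inverse power `1/α` exceeds 1, so distance is a Lipschitz function of height on bounded
sets. The constant comes from Bernoulli's inequality at `b / a` and `a ^ (1 - α) ≤ T`. -/
theorem sub_le_of_rpow {α T a b : ℝ} (hα : α ∈ Ioo (0 : ℝ) 1) (hT : 1 ≤ T) (hb : 0 ≤ b)
    (hba : b ≤ a) (haT : a ≤ T) : a - b ≤ T / α * (a ^ α - b ^ α) := by
  rcases (hb.trans hba).eq_or_lt with h | ha
  · have : b = a := le_antisymm hba (by rw [← h]; exact hb)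
    simp [this]
  have h1 := rpow_one_add_le_one_add_mul_self (s := b / a - 1) (p := α)
    (by have : 0 ≤ b / a := by positivity
        linarith) hα.1.le hα.2.le
  rw [add_sub_cancel, Real.div_rpow hb ha.le, div_le_iff₀ (by positivity)] at h1
  have h2 : α * (a - b) * a ^ α ≤ a * (a ^ α - b ^ α) := by
    have : (1 + α * (b / a - 1)) * a ^ α * a = (a + α * (b - a)) * a ^ α := by
      field_simp
    nlinarith [mul_le_mul_of_nonneg_right h1 ha.le]
  have h3 : a ≤ T * a ^ α := by
    calc a = a ^ (1 - α) * a ^ α := by rw [← Real.rpow_add ha]; simp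
      _ ≤ T * a ^ α := by
        gcongr
        calc a ^ (1 - α) ≤ T ^ (1 - α) := Real.rpow_le_rpow ha.le haT (by linarith [hα.2])
          _ ≤ T ^ (1 : ℝ) := Real.rpow_le_rpow_of_exponent_le hT (by linarith [hα.1])
          _ = T := Real.rpow_one T
  have hpos : 0 < a ^ α := by positivity
  have hdiff : 0 ≤ a ^ α - b ^ α := sub_nonneg.2 (Real.rpow_le_rpow hb hba hα.1.le)
  have h4 : α * (a - b) ≤ T * (a ^ α - b ^ α) := by
    refine le_of_mul_le_mul_right ?_ hpos
    calc α * (a - b) * a ^ α ≤ a * (a ^ α - b ^ α) := h2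
      _ ≤ T * a ^ α * (a ^ α - b ^ α) := by gcongr
      _ = _ := by ring
  rw [div_mul_eq_mul_div, le_div_iff₀ hα.1]
  linarith

/-- In `Fin 2`, `1 - i` is the index of the other coordinate. -/
theorem dist_sq_eq (i : Fin 2) (x y : Plane) :
    dist x y ^ 2 = (x i - y i) ^ 2 + (x (1 - i) - y (1 - i)) ^ 2 := by
  rw [EuclideanSpace.dist_eq, Real.sq_sqrt (Finset.sum_nonneg fun _ _ => sq_nonneg _),
    Fin.sum_univ_two, Real.dist_eq, Real.dist_eq, sq_abs, sq_abs]
  fin_cases i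
  · simp
  · simp [add_comm]

/-- The number `7/10` is a rational below `1/√2`. -/
theorem exists_coord_ge (x y : Plane) : ∃ i : Fin 2, 7 / 10 * dist x y ≤ |x i - y i| := by
  by_contra! h
  have h0 := h 0
  have h1 := h 1
  have h2 := dist_sq_eq 0 x y
  have hd : 0 ≤ dist x y := dist_nonneg
  have e0 := sq_abs (x 0 - y 0)
  have e1 := sq_abs (x 1 - y 1)
  have p0 := abs_nonneg (x 0 - y 0)
  have p1 := abs_nonneg (x 1 - y 1)
  simp only [sub_zero] at h2
  nlinarith

/-- Here `(n, n')` is the vector from a point to its nearest boundary point, `(v, u)` the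
displacement to a second point, and `h` says that the second point is at least `d₂` away from that
boundary point. Moving by `v` lowers the distance at a definite rate because `n ≥ 7d₁/10`, so `v` is
paid for by the change of distance and by `u`. -/
theorem le_of_cone {d₁ d₂ n n' u v : ℝ} (hd₁ : 0 < d₁) (hd₂ : 0 ≤ d₂) (hd : d₂ ≤ 2 * d₁)
    (hv : 0 ≤ v) (hvd : v ≤ d₁ / 2) (hud : |u| ≤ d₁ / 2) (hn : 7 / 10 * d₁ ≤ n) (hn' : |n'| ≤ d₁)
    (h : d₂ ^ 2 ≤ d₁ ^ 2 - 2 * (n * v + n' * u) + (v ^ 2 + u ^ 2)) :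
    v ≤ 4 * (|d₁ - d₂| + |u|) := by
  have hu0 : 0 ≤ |u| := abs_nonneg u
  have hnu : -(n' * u) ≤ d₁ * |u| := by
    calc -(n' * u) ≤ |n' * u| := neg_le_abs _
      _ = |n'| * |u| := abs_mul _ _
      _ ≤ d₁ * |u| := mul_le_mul_of_nonneg_right hn' hu0
  have husq : u ^ 2 ≤ d₁ / 2 * |u| := by
    rw [← sq_abs, sq]
    exact mul_le_mul_of_nonneg_right hud hu0
  have hvsq : v ^ 2 ≤ d₁ / 2 * v := by
    rw [sq]
    exact mul_le_mul_of_nonneg_right hvd hv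
  have hnv : 7 / 10 * d₁ * v ≤ n * v := mul_le_mul_of_nonneg_right hn hv
  have hdd : d₁ ^ 2 - d₂ ^ 2 ≤ 3 * d₁ * |d₁ - d₂| := by
    have h1 : d₁ ^ 2 - d₂ ^ 2 = (d₁ + d₂) * (d₁ - d₂) := by ring
    rw [h1]
    exact (mul_le_mul_of_nonneg_left (le_abs_self _) (by linarith)).trans
      (mul_le_mul_of_nonneg_right (by linarith) (abs_nonneg _))
  have h0 : 0 ≤ d₁ * |d₁ - d₂| := by positivity
  have h1 : 0 ≤ d₁ * |u| := by positivity
  exact le_of_mul_le_mul_left (by linarith) hd₁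

/-- Two points whose nearest points on `Γ` lie in a common direction: the difference along that
direction is controlled by the transverse difference and the difference of distances. -/
theorem abs_coord_sub_le {Γ : Set Plane} {t s : ℝ} (hs : s = 1 ∨ s = -1) (i : Fin 2)
    {y₁ y₂ w₁ w₂ : Plane} (hw₁ : w₁ ∈ Γ) (hw₂ : w₂ ∈ Γ)
    (hd₁ : dist y₁ w₁ = Metric.infDist y₁ Γ) (hd₂ : dist y₂ w₂ = Metric.infDist y₂ Γ)
    (ht : 0 < t) (hlo₁ : t / 2 ≤ Metric.infDist y₁ Γ) (hhi₁ : Metric.infDist y₁ Γ ≤ t)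
    (hlo₂ : t / 2 ≤ Metric.infDist y₂ Γ) (hhi₂ : Metric.infDist y₂ Γ ≤ t)
    (hc₁ : 7 / 10 * Metric.infDist y₁ Γ ≤ s * (w₁ i - y₁ i))
    (hc₂ : 7 / 10 * Metric.infDist y₂ Γ ≤ s * (w₂ i - y₂ i))
    (hy : dist y₁ y₂ ≤ t / 4) :
    |y₁ i - y₂ i| ≤ 4 * (|Metric.infDist y₁ Γ - Metric.infDist y₂ Γ| + |y₁ (1 - i) - y₂ (1 - i)|) := by
  -- By symmetry `y₂` is ahead of `y₁` in the common direction; the estimate then only compares `y₂`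
  -- with the nearest point `w₁` of `y₁`.
  wlog hv : 0 ≤ s * (y₂ i - y₁ i) generalizing y₁ y₂ w₁ w₂
  · have h1 := this hw₂ hw₁ hd₂ hd₁ hlo₂ hhi₂ hlo₁ hhi₁ hc₂ hc₁ (by rwa [dist_comm])
      (by nlinarith)
    rwa [abs_sub_comm, abs_sub_comm (Metric.infDist y₁ Γ), abs_sub_comm (y₁ (1 - i))]
  have hd₂w : Metric.infDist y₂ Γ ≤ dist y₂ w₁ := Metric.infDist_le_dist_of_mem hw₁
  have hd₂0 : 0 ≤ Metric.infDist y₂ Γ := Metric.infDist_nonneg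
  have e1 := dist_sq_eq i y₂ w₁
  have e2 := dist_sq_eq i y₁ w₁
  have e3 := dist_sq_eq i y₁ y₂
  have hy0 : 0 ≤ dist y₁ y₂ := dist_nonneg
  rw [hd₁] at e2
  clear hw₁ hw₂ hd₁ hd₂ hc₂
  generalize Metric.infDist y₁ Γ = d₁ at *
  generalize Metric.infDist y₂ Γ = d₂ at *
  generalize dist y₁ y₂ = δ at *
  generalize dist y₂ w₁ = δ' at *
  generalize y₁ i = a at *
  generalize y₂ i = b at *
  generalize w₁ i = c at *
  generalize y₁ (1 - i) = a' at *
  generalize y₂ (1 - i) = b' at *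
  generalize w₁ (1 - i) = c' at *
  have hs2 : s * s = 1 := by rcases hs with rfl | rfl <;> norm_num
  have hab : |a - b| = s * (b - a) := by
    rw [← abs_of_nonneg hv, abs_mul, abs_sub_comm]
    rcases hs with rfl | rfl <;> simp
  have f1 : δ' ^ 2 = d₁ ^ 2 - 2 * (s * (c - a) * (s * (b - a)) + (c' - a') * (b' - a')) +
      ((s * (b - a)) ^ 2 + (b' - a') ^ 2) := by
    linear_combination e1 - e2 + (-((b - a) ^ 2) + 2 * (c - a) * (b - a)) * hs2
  have f3 : (s * (b - a)) ^ 2 + (b' - a') ^ 2 = δ ^ 2 := by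
    linear_combination -e3 + ((b - a) ^ 2) * hs2
  have hdn : |c' - a'| ≤ d₁ := by
    refine abs_le_of_sq_le_sq ?_ (by linarith)
    rw [e2]
    nlinarith [sq_nonneg (a - c)]
  have hvle : |s * (b - a)| ≤ t / 4 := by
    refine abs_le_of_sq_le_sq ?_ (by linarith)
    nlinarith [sq_nonneg (b' - a')]
  have hule : |b' - a'| ≤ t / 4 := by
    refine abs_le_of_sq_le_sq ?_ (by linarith)
    nlinarith [sq_nonneg (s * (b - a))]
  have hsq : d₂ ^ 2 ≤ δ' ^ 2 := pow_le_pow_left₀ hd₂0 hd₂w 2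
  rw [hab, abs_sub_comm a']
  exact le_of_cone (by linarith) hd₂0 (by linarith) hv
    ((le_abs_self _).trans (by linarith)) (by linarith) hc₁ hdn (hsq.trans f1.le)

/-! ### Area of a piece of the graph. -/

theorem hausdorffMeasure_le_of_injective_bound {X Y : Type*} [MetricSpace X] [MetricSpace Y]
    [MeasurableSpace X] [BorelSpace X] [MeasurableSpace Y] [BorelSpace Y] {S : Set X} {ψ : X → Y}
    {K : NNReal} (h : ∀ x ∈ S, ∀ y ∈ S, dist x y ≤ K * dist (ψ x) (ψ y)) {d : ℝ} (hd : 0 ≤ d) :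
    μH[d] S ≤ (K : ℝ≥0∞) ^ d * μH[d] (ψ '' S) := by
  rcases S.eq_empty_or_nonempty with rfl | ⟨x₀, -⟩
  · simp
  have : Nonempty X := ⟨x₀⟩
  have hinj : InjOn ψ S := fun x hx y hy hxy => by
    have := h x hx y hy
    rw [hxy, dist_self, mul_zero] at this
    exact dist_le_zero.1 this
  have hleft : LeftInvOn (Function.invFunOn ψ S) ψ S := hinj.leftInvOn_invFunOn
  have hlip : LipschitzOnWith K (Function.invFunOn ψ S) (ψ '' S) := by
    refine LipschitzOnWith.of_dist_le_mul ?_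
    rintro _ ⟨x, hx, rfl⟩ _ ⟨y, hy, rfl⟩
    rw [hleft hx, hleft hy]
    exact h x hx y hy
  have := hlip.hausdorffMeasure_image_le hd
  rwa [hleft.image_image] at this

/-- The vertical projection of space onto the plane. -/
noncomputable def proj (P : Space) : Plane := !₂[P 0, P 1]

theorem dist_space_sq (P Q : Space) :
    dist P Q ^ 2 = dist (proj P) (proj Q) ^ 2 + (P 2 - Q 2) ^ 2 := by
  rw [dist_sq_eq 0, EuclideanSpace.dist_eq, Real.sq_sqrt (Finset.sum_nonneg fun _ _ => sq_nonneg _),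
    Fin.sum_univ_three, Real.dist_eq, Real.dist_eq, Real.dist_eq, sq_abs, sq_abs, sq_abs]
  simp [proj]

theorem dist_proj_le (P Q : Space) : dist (proj P) (proj Q) ≤ dist P Q := by
  refine (sq_le_sq₀ dist_nonneg dist_nonneg).1 ?_
  rw [dist_space_sq]
  nlinarith [sq_nonneg (P 2 - Q 2)]

theorem abs_sub_le_dist_space (P Q : Space) : |P 2 - Q 2| ≤ dist P Q := by
  refine abs_le_of_sq_le_sq ?_ dist_nonneg
  rw [dist_space_sq]
  nlinarith [sq_nonneg (dist (proj P) (proj Q))]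

theorem dist_space_le (i : Fin 2) (P Q : Space) : dist P Q ≤ |proj P i - proj Q i| +
    |proj P (1 - i) - proj Q (1 - i)| + |P 2 - Q 2| := by
  refine (sq_le_sq₀ dist_nonneg (by positivity)).1 ?_
  rw [dist_space_sq, dist_sq_eq i, ← sq_abs (proj P i - proj Q i),
    ← sq_abs (proj P (1 - i) - proj Q (1 - i)), ← sq_abs (P 2 - Q 2)]
  have h1 := abs_nonneg (proj P i - proj Q i)
  have h2 := abs_nonneg (proj P (1 - i) - proj Q (1 - i))
  have h3 := abs_nonneg (P 2 - Q 2)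
  nlinarith [mul_nonneg h1 h2, mul_nonneg h1 h3, mul_nonneg h2 h3]

/-- The part of the graph of `± dist(·, Γ) ^ α` over a small disk, in a shell around `Γ`, and
between two heights. -/
def graphPiece (Γ : Set Plane) (α σ t : ℝ) (p : Plane) (ρ a h : ℝ) : Set Space :=
  {P | P 2 = σ * Metric.infDist (proj P) Γ ^ α ∧ Metric.infDist (proj P) Γ ∈ Icc (t / 2) t ∧
    dist (proj P) p ≤ ρ ∧ P 2 ∈ Icc a (a + h)}

/-- Split into four classes by the axis direction in which a nearest boundary point lies. On each
class, transverse coordinate and height determine the point with a Lipschitz inverse, by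
`abs_coord_sub_le` and `sub_le_of_rpow`, and they range over a `2ρ` by `h` rectangle. -/
theorem hausdorffMeasure_graphPiece_le {Γ : Set Plane} (hΓ : IsCompact Γ) (hne : Γ.Nonempty)
    {α T : ℝ} (hα : α ∈ Ioo (0 : ℝ) 1) (hT : 1 ≤ T) {σ : ℝ} (hσ : σ = 1 ∨ σ = -1) {t : ℝ}
    (ht : 0 < t) (htT : t ≤ T) {p : Plane} {ρ a h : ℝ} (hρ : 0 ≤ ρ) (hρt : ρ ≤ t / 8) :
    μH[2] (graphPiece Γ α σ t p ρ a h) ≤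
      ENNReal.ofReal (8 * (6 + 4 * (T / α)) ^ 2 * (ρ * h)) := by
  have hα0 := hα.1
  set L := T / α with hL
  have hL0 : 0 ≤ L := by positivity
  let G : Fin 2 × Bool → Set Space := fun j => {P | P ∈ graphPiece Γ α σ t p ρ a h ∧
    ∃ w ∈ Γ, dist (proj P) w = Metric.infDist (proj P) Γ ∧
      7 / 10 * Metric.infDist (proj P) Γ ≤ (if j.2 then 1 else -1) * (w j.1 - proj P j.1)}
  have hcov : graphPiece Γ α σ t p ρ a h ⊆ ⋃ j ∈ (Finset.univ : Finset (Fin 2 × Bool)), G j := by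
    intro P hP
    obtain ⟨w, hw, hd⟩ := hΓ.exists_infDist_eq_dist hne (proj P)
    obtain ⟨i, hi⟩ := exists_coord_ge w (proj P)
    rw [dist_comm, ← hd] at hi
    rcases le_total 0 (w i - proj P i) with h0 | h0
    · rw [abs_of_nonneg h0] at hi
      exact mem_iUnion₂.2 ⟨(i, true), Finset.mem_univ _, hP, w, hw, hd.symm, by simpa using hi⟩
    · rw [abs_of_nonpos h0] at hi
      exact mem_iUnion₂.2 ⟨(i, false), Finset.mem_univ _, hP, w, hw, hd.symm, by simpa using hi⟩
  have hG : ∀ j, μH[2] (G j) ≤ ENNReal.ofReal (2 * (6 + 4 * L) ^ 2 * (ρ * h)) := by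
    rintro ⟨i, b⟩
    set s : ℝ := if b then 1 else -1 with hs
    have hs1 : s = 1 ∨ s = -1 := by rw [hs]; cases b <;> simp
    let ψ : Space → ℝ × ℝ := fun P => (proj P (1 - i), P 2)
    have hψ : ∀ P ∈ G (i, b), ∀ Q ∈ G (i, b),
        dist P Q ≤ (6 + 4 * L).toNNReal * dist (ψ P) (ψ Q) := by
      rintro P ⟨⟨hP1, hP2, hP3, -⟩, w, hw, hwd, hwc⟩ Q ⟨⟨hQ1, hQ2, hQ3, -⟩, w', hw', hwd', hwc'⟩
      rw [Real.coe_toNNReal _ (by positivity)]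
      have hPQ : dist (proj P) (proj Q) ≤ t / 4 := by
        linarith [dist_triangle_right (proj P) (proj Q) p]
      have h1 := abs_coord_sub_le hs1 i hw hw' hwd hwd' ht hP2.1 hP2.2 hQ2.1 hQ2.2 hwc hwc' hPQ
      have h2 : |Metric.infDist (proj P) Γ - Metric.infDist (proj Q) Γ| ≤ L * |P 2 - Q 2| := by
        have h3 : |P 2 - Q 2| =
            |Metric.infDist (proj P) Γ ^ α - Metric.infDist (proj Q) Γ ^ α| := by
          rw [hP1, hQ1, ← mul_sub, abs_mul]
          rcases hσ with rfl | rfl <;> simp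
        rw [h3]
        rcases le_total (Metric.infDist (proj P) Γ) (Metric.infDist (proj Q) Γ) with h | h
        · rw [abs_sub_comm, abs_of_nonneg (sub_nonneg.2 h), abs_sub_comm, abs_of_nonneg
            (sub_nonneg.2 (Real.rpow_le_rpow Metric.infDist_nonneg h hα.1.le))]
          exact sub_le_of_rpow hα hT Metric.infDist_nonneg h (hQ2.2.trans htT)
        · rw [abs_of_nonneg (sub_nonneg.2 h), abs_of_nonneg
            (sub_nonneg.2 (Real.rpow_le_rpow Metric.infDist_nonneg h hα.1.le))]
          exact sub_le_of_rpow hα hT Metric.infDist_nonneg h (hP2.2.trans htT)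
      have h4 : |proj P (1 - i) - proj Q (1 - i)| ≤ dist (ψ P) (ψ Q) := le_max_left _ _
      have h5 : |P 2 - Q 2| ≤ dist (ψ P) (ψ Q) := le_max_right _ _
      have h6 := dist_space_le i P Q
      have h7 : L * |P 2 - Q 2| ≤ L * dist (ψ P) (ψ Q) := by gcongr
      -- The lost coordinate costs `4 (L + 1)`, the transverse coordinate and the height 1 each: in
      -- total `6 + 4L`.
      linarith
    have himg : ψ '' G (i, b) ⊆ Icc (p (1 - i) - ρ) (p (1 - i) + ρ) ×ˢ Icc a (a + h) := by
      rintro _ ⟨P, ⟨⟨-, -, hP3, hP4⟩, -⟩, rfl⟩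
      refine ⟨?_, hP4⟩
      have h1 := dist_sq_eq i (proj P) p
      have h2 : |proj P (1 - i) - p (1 - i)| ≤ ρ := by
        refine le_trans ?_ hP3
        refine abs_le_of_sq_le_sq ?_ dist_nonneg
        rw [h1]
        nlinarith [sq_nonneg (proj P i - p i)]
      have := abs_le.1 h2
      exact ⟨by linarith, by linarith⟩
    refine (hausdorffMeasure_le_of_injective_bound hψ zero_le_two).trans ?_
    calc _ ≤ ((6 + 4 * L).toNNReal : ℝ≥0∞) ^ (2 : ℝ) *
          μH[2] (Icc (p (1 - i) - ρ) (p (1 - i) + ρ) ×ˢ Icc a (a + h)) := by gcongr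
      _ = ENNReal.ofReal (6 + 4 * L) ^ 2 * (ENNReal.ofReal (2 * ρ) * ENNReal.ofReal h) := by
        rw [hausdorffMeasure_prod_real, Measure.volume_eq_prod, Measure.prod_prod, Real.volume_Icc,
          Real.volume_Icc, ENNReal.rpow_ofNat]
        congr 4 <;> ring
      _ = _ := by
        rw [← ENNReal.ofReal_pow (by positivity), ← ENNReal.ofReal_mul (by positivity),
          ← ENNReal.ofReal_mul (by positivity)]
        congr 1
        ring
  calc μH[2] (graphPiece Γ α σ t p ρ a h)
      ≤ ∑ j ∈ (Finset.univ : Finset (Fin 2 × Bool)), μH[2] (G j) :=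
        (measure_mono hcov).trans (measure_biUnion_finset_le _ _)
    _ ≤ ∑ j ∈ (Finset.univ : Finset (Fin 2 × Bool)),
          ENNReal.ofReal (2 * (6 + 4 * L) ^ 2 * (ρ * h)) := Finset.sum_le_sum fun j _ => hG j
    _ = _ := by
      rw [Finset.sum_const, Finset.card_univ, Fintype.card_prod, Fintype.card_fin,
        Fintype.card_bool, nsmul_eq_mul, ← ENNReal.ofReal_natCast,
        ← ENNReal.ofReal_mul (by positivity)]
      congr 1
      push_cast
      ring

/-! ### Area over a whole shell. -/

theorem exists_cover_closedBall : ∃ n : ℕ, ∀ (p : Plane) (t : ℝ), 0 < t → ∃ Z : Finset Plane,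
    Z.card ≤ n ∧ Metric.closedBall p (2 * t) ⊆ ⋃ z ∈ Z, Metric.closedBall z (t / 8) := by
  classical
  obtain ⟨Y, -, hYf, hY⟩ := (isCompact_closedBall (0 : Plane) 2).finite_cover_balls
    (e := 1 / 8) (by norm_num)
  refine ⟨hYf.toFinset.card, fun p t ht => ⟨hYf.toFinset.image fun y => p + t • y,
    Finset.card_image_le, fun x hx => ?_⟩⟩
  have hx' : t⁻¹ • (x - p) ∈ Metric.closedBall (0 : Plane) 2 := by
    rw [mem_closedBall_zero_iff, norm_smul, Real.norm_of_nonneg (by positivity), ← dist_eq_norm,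
      inv_mul_le_iff₀ ht, mul_comm]
    exact hx
  obtain ⟨y, hy, hxy⟩ := mem_iUnion₂.1 (hY hx')
  refine mem_iUnion₂.2 ⟨p + t • y,
    Finset.mem_image.2 ⟨y, hYf.mem_toFinset.2 hy, rfl⟩, ?_⟩
  have h1 : x - (p + t • y) = t • (t⁻¹ • (x - p) - y) := by
    rw [smul_sub, smul_inv_smul₀ ht.ne']
    abel
  rw [Metric.mem_closedBall, dist_eq_norm, h1, norm_smul, Real.norm_of_nonneg ht.le,
    ← dist_eq_norm]
  have h2 : dist (t⁻¹ • (x - p)) y < 1 / 8 := hxy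
  nlinarith

/-- Area of the part of the graph over a shell around the quasicircle inside a disk. -/
theorem exists_hausdorffMeasure_shell_le {K : ℝ} {f : Plane ≃ₜ Plane} (hf : IsQuasiconformal K f)
    (hW : IsWeakChordArc (f '' Metric.sphere 0 1)) {α T : ℝ} (hα : α ∈ Ioo (0 : ℝ) 1)
    (hT : 1 ≤ T) :
    ∃ C ≥ 1, ∃ R₀ > 0, ∃ M ≥ (1 : ℝ), ∃ B > 0, ∀ σ : ℝ, σ = 1 ∨ σ = -1 → ∀ x : Plane,
      ∀ r ∈ Ioc 0 R₀, ∀ k : ℕ, ∀ t ∈ Ioc 0 T, ∀ a h : ℝ, 0 ≤ h → (C * r) ^ (2 ^ k) ≤ t / 2 →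
        μH[2] (graphPiece (f '' Metric.sphere 0 1) α σ t x r a h) ≤
          ENNReal.ofReal (B * M ^ k * (r * h)) := by
  classical
  set Γ := f '' Metric.sphere 0 1 with hΓ
  have hΓc : IsCompact Γ := (isCompact_sphere _ _).image f.continuous
  have hΓne : Γ.Nonempty := ⟨f (circlePt 0), _, by simp [norm_circlePt], rfl⟩
  obtain ⟨C, hC, R₀, hR₀, M, hM, hCR, hcov⟩ := exists_cover_quasicircle hf hW
  obtain ⟨n, hn⟩ := exists_cover_closedBall
  have hα0 := hα.1
  set E := (6 + 4 * (T / α)) ^ 2 with hE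
  have hE0 : 0 < E := by positivity
  refine ⟨9 * C, by linarith, R₀ / 9, by positivity, M, hM, 88 * C * (n + 1) * E, by positivity, ?_⟩
  rintro σ hσ x r ⟨hr, hrR⟩ k t ⟨ht, htT⟩ a h hh hk
  have hMk : 1 ≤ M ^ k := one_le_pow₀ hM
  rcases le_or_gt r (t / 8) with hrt | hrt
  · refine (hausdorffMeasure_graphPiece_le hΓc hΓne hα hT hσ ht htT hr.le hrt).trans ?_
    refine ENNReal.ofReal_le_ofReal ?_
    have h1 : 8 ≤ 88 * C * (n + 1) := by
      have : (0 : ℝ) ≤ n := n.cast_nonneg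
      nlinarith
    calc 8 * E * (r * h) ≤ 88 * C * (n + 1) * E * (r * h) := by gcongr
      _ = 88 * C * (n + 1) * E * 1 * (r * h) := by ring
      _ ≤ 88 * C * (n + 1) * E * M ^ k * (r * h) := by gcongr
  -- Now `t < 8r`, so a point over the disk has its nearest boundary point within `r + t < 9r` of
  -- `x`.
  obtain ⟨Z, hZ, hZc⟩ := hcov x (9 * r) ⟨by positivity, by linarith⟩ k t ht
    (by rwa [← mul_assoc, mul_comm C 9])
  choose! Y hYn hY using fun p : Plane => hn p t ht
  have hsub : graphPiece Γ α σ t x r a h ⊆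
      ⋃ z ∈ Z, ⋃ y ∈ Y z, graphPiece Γ α σ t y (t / 8) a h := by
    rintro P ⟨hP1, hP2, hP3, hP4⟩
    obtain ⟨w, hw, hd⟩ := hΓc.exists_infDist_eq_dist hΓne (proj P)
    have hdt : dist (proj P) w ≤ t := hd ▸ hP2.2
    have hwx : w ∈ Γ ∩ Metric.closedBall x (9 * r) := by
      refine ⟨hw, ?_⟩
      rw [Metric.mem_closedBall]
      linarith [dist_triangle_left w x (proj P)]
    obtain ⟨z, hz, hwz⟩ := mem_iUnion₂.1 (hZ hwx)
    have hwz' : dist w z < t := hwz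
    have hPz : proj P ∈ Metric.closedBall z (2 * t) := by
      rw [Metric.mem_closedBall]
      linarith [dist_triangle (proj P) w z]
    obtain ⟨y, hy, hPy⟩ := mem_iUnion₂.1 (hY z hPz)
    exact mem_iUnion₂.2 ⟨z, hz, mem_iUnion₂.2 ⟨y, hy, hP1, hP2, hPy, hP4⟩⟩
  have hcard : (Z.card : ℝ) ≤ 88 * C * M ^ k * (r / t) := by
    refine hZc.trans ?_
    -- The additive 2 of the covering number is absorbed because `r / t ≥ 1/8`; hence `88 = 72 +
    -- 16`.
    have h1 : 2 ≤ 16 * (C * M ^ k) * (r / t) := by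
      have h2 : 1 / 8 ≤ r / t := by rw [le_div_iff₀ ht]; linarith
      have h3 : 1 ≤ C * M ^ k := one_le_mul_of_one_le_of_one_le hC hMk
      nlinarith
    have h4 : 8 * (M ^ k * (C * (9 * r))) / t = 72 * (C * M ^ k) * (r / t) := by ring
    rw [h4]
    linarith
  calc μH[2] (graphPiece Γ α σ t x r a h)
      ≤ ∑ z ∈ Z, ∑ y ∈ Y z, μH[2] (graphPiece Γ α σ t y (t / 8) a h) := by
        refine (measure_mono hsub).trans ((measure_biUnion_finset_le _ _).trans ?_)
        exact Finset.sum_le_sum fun z _ => measure_biUnion_finset_le _ _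
    _ ≤ ∑ z ∈ Z, ∑ y ∈ Y z, ENNReal.ofReal (8 * E * (t / 8 * h)) := by
        refine Finset.sum_le_sum fun z _ => Finset.sum_le_sum fun y _ => ?_
        exact hausdorffMeasure_graphPiece_le hΓc hΓne hα hT hσ ht htT (by positivity) le_rfl
    _ ≤ ∑ z ∈ Z, n * ENNReal.ofReal (8 * E * (t / 8 * h)) := by
        refine Finset.sum_le_sum fun z _ => ?_
        rw [Finset.sum_const, nsmul_eq_mul]
        gcongr
        exact hYn z
    _ = ENNReal.ofReal (Z.card * (n * (8 * E * (t / 8 * h)))) := by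
        rw [Finset.sum_const, nsmul_eq_mul, ENNReal.ofReal_mul (p := (Z.card : ℝ)) (by positivity),
          ENNReal.ofReal_mul (p := (n : ℝ)) (by positivity), ENNReal.ofReal_natCast, ENNReal.ofReal_natCast]
    _ ≤ _ := by
        refine ENNReal.ofReal_le_ofReal ?_
        calc Z.card * (n * (8 * E * (t / 8 * h)))
            ≤ (88 * C * M ^ k * (r / t)) * ((n + 1) * (8 * E * (t / 8 * h))) := by
              gcongr
              linarith
          _ = _ := by field_simp

/-- This takes care of the points over the boundary curve, which lie in no shell: they form a subset
of a horizontal disk. -/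
theorem hausdorffMeasure_flat_le (S : Set Space) (x : Plane) {r : ℝ} (hr : 0 ≤ r)
    (hS : ∀ P ∈ S, P 2 = 0 ∧ dist (proj P) x ≤ r) :
    μH[2] S ≤ ENNReal.ofReal (16 * r ^ 2) := by
  let ψ : Space → ℝ × ℝ := fun P => (proj P 0, proj P 1)
  have hψ : ∀ P ∈ S, ∀ Q ∈ S, dist P Q ≤ (2 : NNReal) * dist (ψ P) (ψ Q) := by
    intro P hP Q hQ
    have h := dist_space_le 0 P Q
    rw [(hS P hP).1, (hS Q hQ).1, sub_self, abs_zero, sub_zero] at h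
    have h1 : |proj P 0 - proj Q 0| ≤ dist (ψ P) (ψ Q) := le_max_left _ _
    have h2 : |proj P 1 - proj Q 1| ≤ dist (ψ P) (ψ Q) := le_max_right _ _
    rw [NNReal.coe_ofNat]
    linarith
  have himg : ψ '' S ⊆ Icc (x 0 - r) (x 0 + r) ×ˢ Icc (x 1 - r) (x 1 + r) := by
    rintro _ ⟨P, hP, rfl⟩
    have h := (hS P hP).2
    have h0 : |proj P 0 - x 0| ≤ r := (PiLp.dist_apply_le (proj P) x 0).trans h
    have h1 : |proj P 1 - x 1| ≤ r := (PiLp.dist_apply_le (proj P) x 1).trans h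
    rw [abs_le] at h0 h1
    exact ⟨⟨by linarith, by linarith⟩, ⟨by linarith, by linarith⟩⟩
  refine (hausdorffMeasure_le_of_injective_bound hψ zero_le_two).trans ?_
  calc _ ≤ ((2 : NNReal) : ℝ≥0∞) ^ (2 : ℝ) *
        μH[2] (Icc (x 0 - r) (x 0 + r) ×ˢ Icc (x 1 - r) (x 1 + r)) := by gcongr
    _ = ENNReal.ofReal 2 ^ 2 * (ENNReal.ofReal (2 * r) * ENNReal.ofReal (2 * r)) := by
      rw [hausdorffMeasure_prod_real, Measure.volume_eq_prod, Measure.prod_prod, Real.volume_Icc,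
        Real.volume_Icc, ENNReal.rpow_ofNat]
      congr 3 <;> first | (simp; done) | ring
    _ = _ := by
      rw [← ENNReal.ofReal_pow (by positivity), ← ENNReal.ofReal_mul (by positivity),
        ← ENNReal.ofReal_mul (by positivity)]
      congr 1
      ring

/-! ### Summation over dyadic shells. -/

theorem exists_dyadic {d T : ℝ} (hd : 0 < d) (hdT : d ≤ T) :
    ∃ j : ℕ, d ∈ Icc (T * (1 / 2) ^ j / 2) (T * (1 / 2) ^ j) := by
  have hT : 0 < T := hd.trans_le hdT
  obtain ⟨j, h1, h2⟩ := exists_nat_pow_near_of_lt_one (x := d / T) (y := 1 / 2) (by positivity)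
    (by rwa [div_le_one hT]) (by norm_num) (by norm_num)
  rw [lt_div_iff₀ hT] at h1
  rw [div_le_iff₀ hT] at h2
  refine ⟨j, ?_, by linarith⟩
  rw [pow_succ] at h1
  linarith

/-- The scale at which the iterated partitions are used. -/
def level (m j : ℕ) : ℕ := Nat.clog 2 (2 * (m + j + 1))

theorem le_two_pow_level (m j : ℕ) : 2 * (m + j + 1) ≤ 2 ^ level m j :=
  Nat.le_pow_clog one_lt_two _

theorem two_pow_level_le (m j : ℕ) : 2 ^ level m j ≤ 4 * (m + j + 1) := by
  have h : level m j ≠ 0 := by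
    intro h
    have := le_two_pow_level m j
    rw [h] at this
    omega
  have h1 := Nat.pow_pred_clog_lt_self (b := 2) one_lt_two (x := 2 * (m + j + 1)) (by omega)
  have h2 : 2 ^ level m j = 2 * 2 ^ (level m j).pred := by
    rw [← pow_succ', ← Nat.succ_eq_add_one, Nat.succ_pred_eq_of_ne_zero h]
  rw [h2]
  have h3 : 2 ^ (level m j).pred < 2 * (m + j + 1) := h1
  omega

/-- If `M < 2 ^ c`, then `M ^ level` is at most `(2 ^ level) ^ c`, a polynomial of degree `c` in
`j`, which the geometric factor beats. -/
theorem summable_level {M q : ℝ} (hM : 1 ≤ M) (hq : 0 < q) (hq1 : q < 1) (m : ℕ) :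
    Summable fun j : ℕ => M ^ level m j * q ^ j := by
  obtain ⟨c, hc⟩ := pow_unbounded_of_one_lt M (one_lt_two (α := ℝ))
  have h1 := summable_pow_mul_geometric_of_norm_lt_one (R := ℝ) c (r := q)
    (by rwa [Real.norm_of_nonneg hq.le])
  have h2 := ((summable_nat_add_iff (m + 1)).2 h1).mul_left (4 ^ c * (q ^ (m + 1))⁻¹)
  refine Summable.of_nonneg_of_le (fun j => by positivity) (fun j => ?_) h2
  have h3 : M ^ level m j ≤ (4 * (j + (m + 1) : ℝ)) ^ c := by
    calc M ^ level m j ≤ (2 ^ c) ^ level m j := by gcongr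
      _ = ((2 : ℝ) ^ level m j) ^ c := by rw [← pow_mul, mul_comm, pow_mul]
      _ ≤ _ := by
        gcongr
        have := two_pow_level_le m j
        have h4 : ((2 ^ level m j : ℕ) : ℝ) ≤ ((4 * (m + j + 1) : ℕ) : ℝ) := by exact_mod_cast this
        push_cast at h4
        linarith
  calc M ^ level m j * q ^ j ≤ (4 * (j + (m + 1) : ℝ)) ^ c * q ^ j := by gcongr
    _ = 4 ^ c * (q ^ (m + 1))⁻¹ * (((j + (m + 1) : ℕ) : ℝ) ^ c * q ^ (j + (m + 1))) := by
      rw [mul_pow, pow_add q j]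
      push_cast
      field_simp

/-- The scale condition on the level. -/
theorem pow_level_le {C r α T : ℝ} (hC : 0 ≤ C) (hr : 0 < r) (hr2 : r ≤ 1 / 2)
    (hCr : C ^ 2 * r ≤ 1) {m : ℕ} (hm : 1 / α ≤ m) (hT : r ^ (1 / α) ≤ T) (j : ℕ) :
    (C * r) ^ (2 ^ level m j) ≤ T * (1 / 2) ^ j / 2 := by
  have h1 : (C * r) ^ 2 ≤ r := by nlinarith
  have h0 : 0 ≤ C * r := by positivity
  have h2 : C * r ≤ 1 := by nlinarith
  -- The factor 2 in the exponent trades `(C r)²` for `r`; then `r ^ m ≤ r ^ (1/α) ≤ T` and `r ^ (j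
  -- + 1) ≤ 2 ^ (-(j + 1))`.
  calc (C * r) ^ (2 ^ level m j) ≤ (C * r) ^ (2 * (m + j + 1)) :=
        pow_le_pow_of_le_one h0 h2 (le_two_pow_level m j)
    _ = ((C * r) ^ 2) ^ (m + j + 1) := pow_mul _ _ _
    _ ≤ r ^ (m + j + 1) := by gcongr
    _ = r ^ m * r ^ (j + 1) := by rw [add_assoc, pow_add]
    _ ≤ r ^ (1 / α) * (1 / 2) ^ (j + 1) := by
        gcongr
        rw [← Real.rpow_natCast]
        exact Real.rpow_le_rpow_of_exponent_ge hr (by linarith) hm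
    _ ≤ T * (1 / 2) ^ (j + 1) := by gcongr
    _ = _ := by rw [pow_succ]; ring

/-- The double graph of `± dist(·, Γ) ^ α` over the whole plane. -/
def doubleGraph (Γ : Set Plane) (α : ℝ) : Set Space :=
  {P | P 2 = Metric.infDist (proj P) Γ ^ α ∨ P 2 = -(Metric.infDist (proj P) Γ ^ α)}

/-- The dyadic pieces of the double graph inside a ball. -/
theorem exists_graphPiece_of_mem {Γ : Set Plane} {α : ℝ} (hα : α ∈ Ioo (0 : ℝ) 1) {a : Space} {r σ : ℝ}
    (hr : 0 < r) (hσ : σ = 1 ∨ σ = -1) (j : ℕ) :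
    ∃ b h, 0 ≤ h ∧ h ≤ 6 * r * ((1 / 2) ^ α) ^ j ∧
      {P | P 2 = σ * Metric.infDist (proj P) Γ ^ α ∧
        Metric.infDist (proj P) Γ ∈ Icc ((|a 2| + 2 * r) ^ (1 / α) * (1 / 2) ^ j / 2)
          ((|a 2| + 2 * r) ^ (1 / α) * (1 / 2) ^ j) ∧ dist P a < r} ⊆
      graphPiece Γ α σ ((|a 2| + 2 * r) ^ (1 / α) * (1 / 2) ^ j) (proj a) r b h := by
  have hα0 := hα.1
  set A := |a 2| with hA
  have hA0 : 0 ≤ A := abs_nonneg _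
  set q := ((1 / 2 : ℝ) ^ α) ^ j with hq
  have hq0 : 0 < q := by positivity
  have hTq : ((A + 2 * r) ^ (1 / α) * (1 / 2) ^ j) ^ α = (A + 2 * r) * q := by
    rw [Real.mul_rpow (by positivity) (by positivity), ← Real.rpow_mul (by positivity),
      one_div_mul_cancel hα0.ne', Real.rpow_one, hq, ← Real.rpow_natCast, ← Real.rpow_mul (by positivity),
      ← Real.rpow_natCast, ← Real.rpow_mul (by positivity), mul_comm (j : ℝ)]
  have hup : ∀ P : Space, Metric.infDist (proj P) Γ ≤ (A + 2 * r) ^ (1 / α) * (1 / 2) ^ j →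
      Metric.infDist (proj P) Γ ^ α ≤ (A + 2 * r) * q := by
    intro P hP
    rw [← hTq]
    exact Real.rpow_le_rpow Metric.infDist_nonneg hP hα0.le
  have hpos : ∀ P : Space, 0 ≤ Metric.infDist (proj P) Γ ^ α := fun P =>
    Real.rpow_nonneg Metric.infDist_nonneg _
  -- If `A ≤ 4r`, the heights in the shell are already at most `(A + 2r) q ≤ 6rq`. If `A > 4r` and
  -- `q ≥ 1/2`, the window `2r` of the ball itself is small enough. If `A > 4r` and `q < 1/2`, the
  -- shell stays below height `(A + 2r)/2 < A - r` and misses the ball.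
  rcases le_or_gt A (4 * r) with hAr | hAr
  · refine ⟨if σ = 1 then 0 else -((A + 2 * r) * q), (A + 2 * r) * q, by positivity,
      by gcongr; linarith, ?_⟩
    rintro P ⟨hP1, hP2, hP3⟩
    refine ⟨hP1, hP2, (dist_proj_le P a).trans hP3.le, ?_⟩
    have h1 := hup P hP2.2
    have h2 := hpos P
    rcases hσ with rfl | rfl
    · rw [if_pos rfl, hP1, one_mul]
      exact ⟨h2, by linarith⟩
    · rw [if_neg (by norm_num), hP1]
      exact ⟨by linarith, by linarith⟩
  · by_cases hqs : 1 / 2 ≤ q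
    · refine ⟨a 2 - r, 2 * r, by positivity, by nlinarith, ?_⟩
      rintro P ⟨hP1, hP2, hP3⟩
      refine ⟨hP1, hP2, (dist_proj_le P a).trans hP3.le, ?_⟩
      have h1 := abs_le.1 ((abs_sub_le_dist_space P a).trans hP3.le)
      exact ⟨by linarith, by linarith⟩
    · refine ⟨0, 0, le_rfl, by positivity, ?_⟩
      rintro P ⟨hP1, hP2, hP3⟩
      exfalso
      have h1 := hup P hP2.2
      have h3 : |P 2| ≤ (A + 2 * r) * q := by
        rw [hP1, abs_mul, abs_of_nonneg (hpos P)]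
        rcases hσ with rfl | rfl <;> simpa using h1
      have h4 := (abs_sub_le_dist_space P a).trans hP3.le
      have h5 := abs_sub_abs_le_abs_sub (a 2) (P 2)
      rw [abs_sub_comm] at h5
      push Not at hqs
      nlinarith

/-- Within the ball, distances to the curve are at most `T = (|a 2| + 2r) ^ (1/α)`, so the shells `T
· 2 ^ (-j)` exhaust all points off the curve. The choice `T ≥ r ^ (1/α)` bounds the iteration level
uniformly in the center, which gives a single convergent series. -/
theorem exists_hausdorffMeasure_ball_le {K : ℝ} {f : Plane ≃ₜ Plane} (hf : IsQuasiconformal K f)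
    (hW : IsWeakChordArc (f '' Metric.sphere 0 1)) {α H : ℝ} (hα : α ∈ Ioo (0 : ℝ) 1) :
    ∃ B > 0, ∃ R₀ > 0, ∀ a : Space, |a 2| ≤ H → ∀ r ∈ Ioc 0 R₀,
      μH[2] (doubleGraph (f '' Metric.sphere 0 1) α ∩ Metric.ball a r) ≤
        ENNReal.ofReal (B * r ^ 2) := by
  set Γ := f '' Metric.sphere 0 1 with hΓ
  have hα0 := hα.1
  obtain ⟨C, hC, R₁, hR₁, M, hM, B, hB, hshell⟩ := exists_hausdorffMeasure_shell_le hf hW hα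
    (T := max 1 ((|H| + 2) ^ (1 / α))) (le_max_left _ _)
  obtain ⟨m, hm⟩ := exists_nat_ge (1 / α)
  set q : ℝ := (1 / 2) ^ α with hq
  have hq0 : 0 < q := by positivity
  have hq1 : q < 1 := Real.rpow_lt_one (by norm_num) (by norm_num) hα0
  have hsum := summable_level hM hq0 hq1 m
  set S := ∑' j, M ^ level m j * q ^ j with hS
  have hS0 : 0 ≤ S := tsum_nonneg fun j => by positivity
  refine ⟨16 + 2 * (6 * B * S), by positivity, min R₁ (min (1 / 2) (1 / C ^ 2)), by positivity, ?_⟩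
  rintro a ha r ⟨hr, hrR⟩
  have hrR₁ : r ≤ R₁ := hrR.trans (min_le_left _ _)
  have hr2 : r ≤ 1 / 2 := hrR.trans ((min_le_right _ _).trans (min_le_left _ _))
  have hCr : C ^ 2 * r ≤ 1 := by
    have : r ≤ 1 / C ^ 2 := hrR.trans ((min_le_right _ _).trans (min_le_right _ _))
    rwa [le_div_iff₀ (by positivity), mul_comm] at this
  set T := (|a 2| + 2 * r) ^ (1 / α) with hT
  have ha0 : 0 ≤ |a 2| := abs_nonneg _
  have hrT : r ^ (1 / α) ≤ T := Real.rpow_le_rpow hr.le (by linarith) (by positivity)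
  have hT0 : 0 < T := by positivity
  have hTmax : T ≤ max 1 ((|H| + 2) ^ (1 / α)) := by
    refine le_max_of_le_right (Real.rpow_le_rpow (by positivity) ?_ (by positivity))
    linarith [le_abs_self H]
  let S' : ℝ → ℕ → Set Space := fun σ j => {P | P 2 = σ * Metric.infDist (proj P) Γ ^ α ∧
        Metric.infDist (proj P) Γ ∈ Icc (T * (1 / 2) ^ j / 2) (T * (1 / 2) ^ j) ∧ dist P a < r}
  have hpiece : ∀ σ : ℝ, σ = 1 ∨ σ = -1 → ∀ j,
      μH[2] (S' σ j) ≤ ENNReal.ofReal (6 * B * r ^ 2 * (M ^ level m j * q ^ j)) := by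
    intro σ hσ j
    obtain ⟨b, h, hh, hhle, hsub⟩ := exists_graphPiece_of_mem (Γ := Γ) hα (a := a) hr hσ j
    refine (measure_mono hsub).trans ((hshell σ hσ (proj a) r ⟨hr, hrR₁⟩ (level m j) _ ⟨?_, ?_⟩ b h hh
      (pow_level_le (by linarith) hr hr2 hCr hm hrT j)).trans (ENNReal.ofReal_le_ofReal ?_))
    · positivity
    · refine le_trans ?_ hTmax
      exact mul_le_of_le_one_right hT0.le (pow_le_one₀ (by norm_num) (by norm_num))
    · have hM0 : 0 ≤ M := by linarith
      calc B * M ^ level m j * (r * h) ≤ B * M ^ level m j * (r * (6 * r * q ^ j)) := by gcongr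
        _ = _ := by ring
  have hside : ∀ σ : ℝ, σ = 1 ∨ σ = -1 →
      μH[2] (⋃ j, S' σ j) ≤ ENNReal.ofReal (6 * B * S * r ^ 2) := by
    intro σ hσ
    calc μH[2] (⋃ j, S' σ j) ≤ ∑' j, μH[2] (S' σ j) := measure_iUnion_le _
      _ ≤ ∑' j, ENNReal.ofReal (6 * B * r ^ 2 * (M ^ level m j * q ^ j)) :=
        ENNReal.tsum_le_tsum (hpiece σ hσ)
      _ = ENNReal.ofReal (∑' j, 6 * B * r ^ 2 * (M ^ level m j * q ^ j)) := by
        rw [ENNReal.ofReal_tsum_of_nonneg (fun j => by positivity) (hsum.mul_left _)]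
      _ = _ := by
        rw [tsum_mul_left, ← hS]
        congr 1
        ring
  have hcov : doubleGraph Γ α ∩ Metric.ball a r ⊆
      {P | P 2 = 0 ∧ dist (proj P) (proj a) ≤ r} ∪ ((⋃ j, S' 1 j) ∪ ⋃ j, S' (-1) j) := by
    rintro P ⟨hP, hPa⟩
    have hPa' : dist P a < r := hPa
    have hnn : 0 ≤ Metric.infDist (proj P) Γ := Metric.infDist_nonneg
    rcases hnn.eq_or_lt with h0 | h0
    · left
      refine ⟨?_, (dist_proj_le P a).trans hPa'.le⟩
      rcases hP with h | h <;> simp [h, ← h0, Real.zero_rpow hα0.ne']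
    · right
      have hle : Metric.infDist (proj P) Γ ≤ T := by
        have h1 : |P 2| = Metric.infDist (proj P) Γ ^ α := by
          rcases hP with h | h
          · rw [h, abs_of_nonneg (by positivity)]
          · rw [h, abs_neg, abs_of_nonneg (by positivity)]
        have h2 : Metric.infDist (proj P) Γ ^ α ≤ |a 2| + 2 * r := by
          have h3 := (abs_sub_le_dist_space P a).trans hPa'.le
          have h4 := abs_sub_abs_le_abs_sub (P 2) (a 2)
          linarith
        calc Metric.infDist (proj P) Γ = (Metric.infDist (proj P) Γ ^ α) ^ (1 / α) := by
              rw [← Real.rpow_mul h0.le, mul_one_div_cancel hα0.ne', Real.rpow_one]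
          _ ≤ T := Real.rpow_le_rpow (by positivity) h2 (by positivity)
      obtain ⟨j, hj⟩ := exists_dyadic h0 hle
      rcases hP with h | h
      · exact Or.inl (mem_iUnion.2 ⟨j, by rw [h, one_mul], hj, hPa'⟩)
      · exact Or.inr (mem_iUnion.2 ⟨j, by rw [h, neg_one_mul], hj, hPa'⟩)
  calc _ ≤ ENNReal.ofReal (16 * r ^ 2) +
        (ENNReal.ofReal (6 * B * S * r ^ 2) + ENNReal.ofReal (6 * B * S * r ^ 2)) := by
        refine (measure_mono hcov).trans ((measure_union_le _ _).trans ?_)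
        refine add_le_add (hausdorffMeasure_flat_le _ (proj a) hr.le fun P hP => hP)
          ((measure_union_le _ _).trans ?_)
        exact add_le_add (hside 1 (Or.inl rfl)) (hside (-1) (Or.inr rfl))
    _ = _ := by
        rw [← ENNReal.ofReal_add (by positivity) (by positivity),
          ← ENNReal.ofReal_add (by positivity) (by positivity)]
        congr 1
        ring

/-! ### Level curves and the lower area bound. -/

section LevelSets

variable {Ω : Set Plane}

theorem IsJordanDomain.frontier_nonempty (hΩ : IsJordanDomain Ω) : (frontier Ω).Nonempty := by
  obtain ⟨c, -, -, h⟩ := hΩ.isJordanCurve_frontier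
  exact h ▸ range_nonempty c

theorem IsJordanDomain.isCompact_frontier (hΩ : IsJordanDomain Ω) : IsCompact (frontier Ω) := by
  obtain ⟨c, hc, -, h⟩ := hΩ.isJordanCurve_frontier
  exact h ▸ isCompact_range hc

theorem IsJordanDomain.ball_subset (hΩ : IsJordanDomain Ω) {x : Plane} (hx : x ∈ closure Ω)
    (hd : 0 < Metric.infDist x (frontier Ω)) :
    Metric.ball x (Metric.infDist x (frontier Ω)) ⊆ Ω := by
  have hxΩ : x ∈ Ω := by
    by_contra h
    have hf : x ∈ frontier Ω := by
      rw [hΩ.isOpen.frontier_eq]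
      exact ⟨hx, h⟩
    rw [Metric.infDist_zero_of_mem hf] at hd
    exact lt_irrefl _ hd
  exact IsPreconnected.subset_of_disjoint_frontier (convex_ball _ _).isPreconnected hΩ.isOpen
    ⟨x, Metric.mem_ball_self hd, hxΩ⟩ Metric.disjoint_ball_infDist

/-- Lower level sets are reached by moving towards the boundary. -/
theorem IsJordanDomain.exists_mem_levelSet (hΩ : IsJordanDomain Ω) {x : Plane} (hx : x ∈ closure Ω)
    {ε : ℝ} (hε : 0 ≤ ε) (hεd : ε ≤ Metric.infDist x (frontier Ω)) :
    ∃ y ∈ levelSet Ω ε, dist y x = Metric.infDist x (frontier Ω) - ε := by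
  rcases (hε.trans hεd).eq_or_lt with h0 | h0
  · have : ε = 0 := le_antisymm (h0 ▸ hεd) hε
    exact ⟨x, ⟨hx, by rw [this, h0]⟩, by rw [dist_self, this, ← h0, sub_zero]⟩
  obtain ⟨w, hw, hd⟩ := hΩ.isCompact_frontier.exists_infDist_eq_dist hΩ.frontier_nonempty x
  set D := Metric.infDist x (frontier Ω) with hD
  set s := (D - ε) / D with hs
  have hs0 : 0 ≤ s := div_nonneg (by linarith) h0.le
  have hs1 : s ≤ 1 := by rw [hs, div_le_one h0]; linarith
  have hsD : s * D = D - ε := div_mul_cancel₀ _ h0.ne'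
  set y := AffineMap.lineMap x w s with hy
  have hyx : dist y x = D - ε := by
    rw [hy, dist_lineMap_left, Real.norm_of_nonneg hs0, ← hd, hsD]
  have hyw : dist y w = ε := by
    rw [hy, dist_lineMap_right, Real.norm_of_nonneg (by linarith), ← hd]
    linarith
  refine ⟨y, ⟨?_, ?_⟩, hyx⟩
  · rcases hε.eq_or_lt with h | h
    · have : y = w := dist_eq_zero.1 (by rw [hyw, h])
      rw [this]
      exact frontier_subset_closure hw
    · refine subset_closure (hΩ.ball_subset hx h0 ?_)
      rw [Metric.mem_ball, hyx]
      linarith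
  · refine le_antisymm ?_ ?_
    · exact (Metric.infDist_le_dist_of_mem hw).trans hyw.le
    · have := Metric.infDist_le_infDist_add_dist (s := frontier Ω) (x := x) (y := y)
      rw [dist_comm, hyx, ← hD] at this
      linarith

theorem isPreconnected_levelSet {K ε : ℝ} (h : IsQuasicircle K (levelSet Ω ε)) :
    IsPreconnected (levelSet Ω ε) := by
  obtain ⟨f, -, h⟩ := h
  rw [← h, sphere_eq_range_circlePt]
  exact (isPreconnected_range lipschitzWith_circlePt.continuous).image _ f.continuous.continuousOn

end LevelSets

theorem mem_doubleDome_iff {Ω : Set Plane} {α : ℝ} {P : Space} :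
    P ∈ doubleDome Ω α ↔ proj P ∈ closure Ω ∧ P ∈ doubleGraph (frontier Ω) α := by
  constructor
  · rintro ⟨x, hx, z, hz, rfl⟩
    have h1 : proj !₂[x 0, x 1, z] = x := by
      ext i
      fin_cases i <;> simp [proj]
    refine ⟨by rwa [h1], ?_⟩
    change (_ = _ ∨ _ = _)
    rw [h1]
    simpa using hz
  · rintro ⟨h1, h2⟩
    refine ⟨proj P, h1, P 2, h2, ?_⟩
    ext i
    fin_cases i <;> simp [proj]

/-- The point of space over `y` at height `z`. -/
noncomputable def lift (y : Plane) (z : ℝ) : Space := !₂[y 0, y 1, z]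

@[simp] theorem proj_lift (y : Plane) (z : ℝ) : proj (lift y z) = y := by
  ext i
  fin_cases i <;> simp [proj, lift]

@[simp] theorem lift_two (y : Plane) (z : ℝ) : lift y z 2 = z := by
  simp [lift]

theorem dist_lift_lt {a : Space} {y : Plane} {z r : ℝ} (hr : 0 < r)
    (h1 : dist y (proj a) ≤ r / 2) (h2 : |z - a 2| ≤ r / 2) : dist (lift y z) a < r := by
  refine lt_of_pow_lt_pow_left₀ 2 hr.le ?_
  rw [dist_space_sq, proj_lift, lift_two, ← sq_abs (z - a 2)]
  have := dist_nonneg (x := y) (y := proj a)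
  have := abs_nonneg (z - a 2)
  nlinarith

theorem ofReal_le_hausdorffMeasure_of_rect {S : Set Space} {ψ : Space → ℝ × ℝ}
    (hψ : LipschitzWith 1 ψ) {a b h l : ℝ} (hh : 0 ≤ h)
    (hS : Icc a (a + h) ×ˢ Icc b (b + l) ⊆ ψ '' S) : ENNReal.ofReal (h * l) ≤ μH[2] S := by
  have h1 := hψ.hausdorffMeasure_image_le zero_le_two S
  rw [ENNReal.coe_one, ENNReal.one_rpow, one_mul] at h1
  refine le_trans ?_ ((measure_mono hS).trans h1)
  rw [hausdorffMeasure_prod_real, Measure.volume_eq_prod, Measure.prod_prod, Real.volume_Icc,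
    Real.volume_Icc, add_sub_cancel_left, add_sub_cancel_left, ENNReal.ofReal_mul hh]

/-- Lower bound for the area when the level sets in a range of heights cross a planar annulus. -/
theorem ofReal_le_of_levelSets {Ω : Set Plane} {α σ : ℝ} (hα : 0 < α) (hσ : σ = 1 ∨ σ = -1)
    {a : Space} {r u l : ℝ} (hr : 0 < r) (hu : 0 ≤ u)
    (hz : ∀ z ∈ Icc u (u + l), |z - σ * a 2| ≤ r / 2 ∧
      IsPreconnected (levelSet Ω (z ^ (1 / α))) ∧
      (∃ y ∈ levelSet Ω (z ^ (1 / α)), dist y (proj a) ≤ r / 4) ∧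
      ∃ y ∈ levelSet Ω (z ^ (1 / α)), r / 2 ≤ dist y (proj a)) :
    ENNReal.ofReal (r / 4 * l) ≤ μH[2] (doubleDome Ω α ∩ Metric.ball a r) := by
  -- At each height in the window the level set is connected and crosses the annulus, so the first
  -- component takes all values in `[r/4, r/2]`.
  let ψ : Space → ℝ × ℝ := fun P => (dist (proj P) (proj a), σ * P 2)
  have hψ : LipschitzWith 1 ψ := by
    refine LipschitzWith.of_dist_le_mul fun P Q => ?_
    rw [NNReal.coe_one, one_mul]
    refine max_le ?_ ?_
    · rw [Real.dist_eq]
      exact (abs_dist_sub_le _ _ _).trans (dist_proj_le P Q)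
    · rw [Real.dist_eq, ← mul_sub, abs_mul]
      refine le_trans (le_of_eq ?_) (abs_sub_le_dist_space P Q)
      rcases hσ with rfl | rfl <;> simp
  refine ofReal_le_hausdorffMeasure_of_rect hψ (a := r / 4) (b := u) (by positivity) ?_
  rintro ⟨s, z⟩ ⟨hs, hzI⟩
  obtain ⟨h1, h2, ⟨y₁, hy₁, hd₁⟩, y₂, hy₂, hd₂⟩ := hz z hzI
  simp only at hs hzI
  obtain ⟨y, hy, hys⟩ := h2.intermediate_value hy₁ hy₂ (f := fun y => dist y (proj a)) (by fun_prop)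
    ⟨hd₁.trans hs.1, le_trans (by linarith [hs.2]) hd₂⟩
  simp only at hys
  have hz0 : 0 ≤ z := hu.trans hzI.1
  have hyz : Metric.infDist y (frontier Ω) ^ α = z := by
    rw [hy.2, ← Real.rpow_mul hz0, one_div_mul_cancel hα.ne', Real.rpow_one]
  refine ⟨lift y (σ * z), ⟨mem_doubleDome_iff.2 ⟨by rw [proj_lift]; exact hy.1, ?_⟩, ?_⟩, ?_⟩
  · change (_ = _ ∨ _ = _)
    rw [proj_lift, lift_two, hyz]
    rcases hσ with rfl | rfl <;> simp
  · refine dist_lift_lt hr (by rw [hys]; linarith [hs.2]) ?_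
    refine le_trans (le_of_eq ?_) h1
    rcases hσ with rfl | rfl
    · simp
    · rw [← abs_neg]
      congr 1
      ring
  · simp only [ψ, proj_lift, lift_two, hys]
    rcases hσ with rfl | rfl <;> simp

/-- Away from 0 the height is a Lipschitz function of the distance, by Bernoulli's inequality at `a
/ b`. -/
theorem rpow_sub_rpow_le {α δ a b : ℝ} (hα : α ∈ Ioo (0 : ℝ) 1) (hδ : 0 < δ) (hδb : δ ≤ b)
    (hba : b ≤ a) : a ^ α - b ^ α ≤ δ ^ (α - 1) * (a - b) := by
  have hα0 := hα.1
  have hb : 0 < b := hδ.trans_le hδb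
  have h1 := rpow_one_add_le_one_add_mul_self (s := a / b - 1) (p := α)
    (by have : 0 ≤ a / b := div_nonneg (hb.le.trans hba) hb.le
        linarith) hα.1.le hα.2.le
  rw [add_sub_cancel, Real.div_rpow (hb.le.trans hba) hb.le, div_le_iff₀ (by positivity)] at h1
  have h2 : (1 + α * (a / b - 1)) * b ^ α = b ^ α + α * b ^ (α - 1) * (a - b) := by
    rw [Real.rpow_sub_one hb.ne']
    field_simp
  have h3 : b ^ (α - 1) ≤ δ ^ (α - 1) :=
    Real.rpow_le_rpow_of_nonpos hδ hδb (by linarith [hα.2])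
  have h4 : α * b ^ (α - 1) ≤ δ ^ (α - 1) :=
    (mul_le_of_le_one_left (by positivity) hα.2.le).trans h3
  have h5 : α * b ^ (α - 1) * (a - b) ≤ δ ^ (α - 1) * (a - b) :=
    mul_le_mul_of_nonneg_right h4 (by linarith)
  linarith

/-- Lower bound for the area away from the boundary curve. -/
theorem ofReal_le_of_far {Ω : Set Plane} (hΩ : IsJordanDomain Ω) {α ε : ℝ} (hα : α ∈ Ioo (0 : ℝ) 1)
    (hε : 0 < ε) : ∃ κ > 0, ∀ a ∈ doubleDome Ω α, ε ≤ Metric.infDist (proj a) (frontier Ω) →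
      ∀ r ∈ Ioc 0 ε, ENNReal.ofReal (κ * r ^ 2) ≤ μH[2] (doubleDome Ω α ∩ Metric.ball a r) := by
  set L := (ε / 2) ^ (α - 1) with hL
  have hL0 : 0 < L := by positivity
  -- Over a square of side `κ r` around the center, both the horizontal displacement and the change
  -- of height, with Lipschitz constant `L` at distances at least `ε/2`, stay below `r/2`.
  set κ := min (1 / 2) (1 / (2 * L)) with hκ
  have hκ0 : 0 < κ := by positivity
  have hκ2 : κ ≤ 1 / 2 := min_le_left _ _
  have hκL : L * κ ≤ 1 / 2 := by
    calc L * κ ≤ L * (1 / (2 * L)) := by gcongr; exact min_le_right _ _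
      _ = 1 / 2 := by field_simp
  refine ⟨κ ^ 2, by positivity, ?_⟩
  rintro a ha hεa r ⟨hr, hrε⟩
  obtain ⟨hax, haz⟩ := mem_doubleDome_iff.1 ha
  let ψ : Space → ℝ × ℝ := fun P => (proj P 0, proj P 1)
  have hψ : LipschitzWith 1 ψ := by
    refine LipschitzWith.of_dist_le_mul fun P Q => ?_
    rw [NNReal.coe_one, one_mul]
    exact max_le ((PiLp.dist_apply_le (proj P) (proj Q) 0).trans (dist_proj_le P Q))
      ((PiLp.dist_apply_le (proj P) (proj Q) 1).trans (dist_proj_le P Q))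
  have h := ofReal_le_hausdorffMeasure_of_rect hψ (a := proj a 0 - κ * r / 2)
    (b := proj a 1 - κ * r / 2) (h := κ * r) (l := κ * r) (by positivity)
    (S := doubleDome Ω α ∩ Metric.ball a r) ?_
  · refine le_trans (ENNReal.ofReal_le_ofReal (le_of_eq ?_)) h
    ring
  rintro ⟨s, s'⟩ ⟨hs, hs'⟩
  simp only at hs hs'
  set y : Plane := !₂[s, s'] with hy
  have hκr : 0 < κ * r := by positivity
  have hyx : dist y (proj a) ≤ κ * r := by
    refine (sq_le_sq₀ dist_nonneg hκr.le).1 ?_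
    rw [dist_sq_eq 0]
    have h0 : y 0 = s := rfl
    have h1 : y (1 - 0) = s' := rfl
    have h2 : proj a (1 - 0) = proj a 1 := rfl
    rw [h0, h1, h2]
    have h3 : |s - proj a 0| ≤ κ * r / 2 := abs_le.2 ⟨by linarith [hs.1], by linarith [hs.2]⟩
    have h4 : |s' - proj a 1| ≤ κ * r / 2 := abs_le.2 ⟨by linarith [hs'.1], by linarith [hs'.2]⟩
    rw [← sq_abs (s - proj a 0), ← sq_abs (s' - proj a 1)]
    have := abs_nonneg (s - proj a 0)
    have := abs_nonneg (s' - proj a 1)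
    nlinarith
  set dx := Metric.infDist (proj a) (frontier Ω) with hdx
  set dy := Metric.infDist y (frontier Ω) with hdy
  have hdist1 : dx ≤ dy + dist y (proj a) := by
    rw [dist_comm]; exact Metric.infDist_le_infDist_add_dist
  have hdist2 : dy ≤ dx + dist y (proj a) := Metric.infDist_le_infDist_add_dist
  have hκrε : κ * r ≤ ε / 2 := by nlinarith
  have hyΩ : y ∈ closure Ω := by
    refine subset_closure (hΩ.ball_subset hax (by linarith) ?_)
    rw [Metric.mem_ball]
    linarith
  have hdiff : |dy ^ α - dx ^ α| ≤ r / 2 := by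
    have hLr : L * (κ * r) ≤ r / 2 := by nlinarith
    have hε2 : 0 < ε / 2 := by positivity
    rcases le_total dx dy with h | h
    · rw [abs_of_nonneg (sub_nonneg.2 (Real.rpow_le_rpow Metric.infDist_nonneg h hα.1.le))]
      refine (rpow_sub_rpow_le hα hε2 (by linarith) h).trans (le_trans ?_ hLr)
      gcongr
      linarith
    · rw [abs_sub_comm,
        abs_of_nonneg (sub_nonneg.2 (Real.rpow_le_rpow Metric.infDist_nonneg h hα.1.le))]
      refine (rpow_sub_rpow_le hα hε2 (by linarith) h).trans (le_trans ?_ hLr)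
      gcongr
      linarith
  have hψy : ∀ z, ψ (lift y z) = (s, s') := fun z => by
    simp only [ψ, proj_lift]
    rfl
  have hyr : dist y (proj a) ≤ r / 2 := hyx.trans (by nlinarith)
  rcases haz with haz | haz
  · refine ⟨lift y (dy ^ α), ⟨mem_doubleDome_iff.2 ⟨by rwa [proj_lift], Or.inl ?_⟩, ?_⟩, hψy _⟩
    · rw [proj_lift, lift_two]
    · exact dist_lift_lt hr hyr (by rwa [haz])
  · refine ⟨lift y (-(dy ^ α)), ⟨mem_doubleDome_iff.2 ⟨by rwa [proj_lift], Or.inr ?_⟩, ?_⟩, hψy _⟩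
    · rw [proj_lift, lift_two]
    · refine dist_lift_lt hr hyr ?_
      rw [haz, ← abs_neg]
      convert hdiff using 2
      ring

theorem HasLQC.exists_quasiconformal {Ω : Set Plane} (hΩ : IsJordanDomain Ω) (h : HasLQC Ω) :
    ∃ K, ∃ f : Plane ≃ₜ Plane, IsQuasiconformal K f ∧ f '' Metric.sphere 0 1 = frontier Ω := by
  obtain ⟨ε₀, hε₀, K, -, h⟩ := h
  obtain ⟨f, hf, hfΓ⟩ := h 0 ⟨le_rfl, hε₀.le⟩
  refine ⟨K, f, hf, hfΓ.trans ?_⟩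
  ext x
  constructor
  · rintro ⟨-, hx⟩
    exact (hΩ.isCompact_frontier.isClosed.mem_iff_infDist_zero hΩ.frontier_nonempty).2 hx
  · exact fun hx => ⟨frontier_subset_closure hx, Metric.infDist_zero_of_mem hx⟩

/-- Lower area bound for small balls centered on the surface. -/
theorem exists_le_hausdorffMeasure_ball {Ω : Set Plane} (hΩ : IsJordanDomain Ω) (hL : HasLQC Ω)
    {α : ℝ} (hα : α ∈ Ioo (0 : ℝ) 1) :
    ∃ c > 0, ∃ R₀ > 0, ∀ a ∈ doubleDome Ω α, ∀ r ∈ Ioc 0 R₀,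
      ENNReal.ofReal (c * r ^ 2) ≤ μH[2] (doubleDome Ω α ∩ Metric.ball a r) := by
  have hα0 := hα.1
  obtain ⟨K, f, hf, hfΓ⟩ := hL.exists_quasiconformal hΩ
  obtain ⟨ε₀, hε₀, K', -, hlev⟩ := hL
  obtain ⟨c₁, hc₁, R₁, hR₁, hcork⟩ := hf.exists_corkscrew
  rw [hfΓ, ← hΩ.eq_image_ball hfΓ] at hcork
  obtain ⟨p, hp, q, hq, hpq⟩ : ∃ p ∈ frontier Ω, ∃ q ∈ frontier Ω, 0 < dist p q := by
    refine ⟨f (circlePt 0), hfΓ ▸ ⟨_, by simp [norm_circlePt], rfl⟩, f (circlePt Real.pi),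
      hfΓ ▸ ⟨_, by simp [norm_circlePt], rfl⟩, dist_pos.2 fun h => ?_⟩
    have h1 := congrArg (fun x : Plane => x 0) (f.injective h)
    norm_num [circlePt] at h1
  set m := dist p q with hm
  -- A corkscrew point at distance `ρ` from `w` has depth between `c₁ρ` and `ρ`; descending from it
  -- to depth `ε` costs at most another `ρ`.
  have hreach : ∀ w ∈ frontier Ω, ∀ ρ ∈ Ioc 0 R₁, ∀ ε, 0 ≤ ε → ε ≤ c₁ * ρ →
      ∃ y ∈ levelSet Ω ε, dist y w ≤ 2 * ρ := by
    rintro w hw ρ hρ ε hε hερ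
    obtain ⟨y₀, hy₀, hd₀, hfar⟩ := hcork w hw ρ hρ
    have h1 : c₁ * ρ ≤ Metric.infDist y₀ (frontier Ω) :=
      (Metric.le_infDist hΩ.frontier_nonempty).2 fun z => hfar z
    obtain ⟨y, hy, hyd⟩ := hΩ.exists_mem_levelSet (subset_closure hy₀) hε (hερ.trans h1)
    refine ⟨y, hy, ?_⟩
    have h2 := Metric.infDist_le_dist_of_mem hw (x := y₀)
    linarith [dist_triangle y y₀ w]
  set ρ₁ := min R₁ (m / 8) with hρ₁
  have hρ₁0 : 0 < ρ₁ := by positivity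
  set ε₁ := min ε₀ (min 1 (c₁ * ρ₁)) with hε₁
  have hε₁0 : 0 < ε₁ := by positivity
  have hε₁₀ : ε₁ ≤ ε₀ := min_le_left _ _
  have hε₁₁ : ε₁ ≤ 1 := (min_le_right _ _).trans (min_le_left _ _)
  have hε₁ρ : ε₁ ≤ c₁ * ρ₁ := (min_le_right _ _).trans (min_le_right _ _)
  -- The level set has points within `m/4` of both `p` and `q`, hence two points at least `m/2`
  -- apart, which do not both fit in an open disk of radius `r/2 ≤ m/4`.
  have hfar : ∀ x : Plane, ∀ r ≤ m / 2, ∀ ε, 0 ≤ ε → ε ≤ ε₁ →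
      ∃ y ∈ levelSet Ω ε, r / 2 ≤ dist y x := by
    intro x r hr ε hε hεε
    obtain ⟨y, hy, hyp⟩ := hreach p hp ρ₁ ⟨hρ₁0, min_le_left _ _⟩ ε hε (hεε.trans hε₁ρ)
    obtain ⟨y', hy', hyq⟩ := hreach q hq ρ₁ ⟨hρ₁0, min_le_left _ _⟩ ε hε (hεε.trans hε₁ρ)
    have h8 : ρ₁ ≤ m / 8 := min_le_right _ _
    by_contra! hcon
    have h1 := hcon y hy
    have h2 := hcon y' hy'
    have h3 := dist_triangle_left p q y
    have h4 := dist_triangle_right y q y'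
    have h5 := dist_triangle_right y y' x
    linarith [dist_comm q y', dist_triangle y y' q]
  obtain ⟨κ, hκ, hκfar⟩ := ofReal_le_of_far hΩ hα hε₁0
  set β := min (α / 16) (min c₁ 1 / 16) with hβ
  have hβ0 : 0 < β := by positivity
  have hβα : β ≤ α / 16 := min_le_left _ _
  have hβc : β ≤ c₁ / 16 := (min_le_right _ _).trans (by gcongr; exact min_le_left _ _)
  have hβ1 : β ≤ 1 / 16 := (min_le_right _ _).trans (by gcongr; exact min_le_right _ _)
  have hrpow : ∀ z : ℝ, 0 ≤ z → z ≤ 1 → z ^ (1 / α) ≤ z := fun z hz0 hz1 =>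
    Real.rpow_le_self_of_le_one hz0 hz1 ((one_le_div hα0).2 hα.2.le)
  refine ⟨min κ (β / 4), by positivity, min ε₁ (min R₁ (m / 2)), by positivity, ?_⟩
  rintro a ha r ⟨hr, hrR⟩
  have hrε : r ≤ ε₁ := hrR.trans (min_le_left _ _)
  have hrR₁ : r ≤ R₁ := hrR.trans ((min_le_right _ _).trans (min_le_left _ _))
  have hrm : r ≤ m / 2 := hrR.trans ((min_le_right _ _).trans (min_le_right _ _))
  rcases le_total ε₁ (Metric.infDist (proj a) (frontier Ω)) with h | h
  · refine le_trans (ENNReal.ofReal_le_ofReal ?_) (hκfar a ha h r ⟨hr, hrε⟩)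
    gcongr
    exact min_le_left _ _
  obtain ⟨hax, haz⟩ := mem_doubleDome_iff.1 ha
  set d := Metric.infDist (proj a) (frontier Ω) with hd
  have hd0 : 0 ≤ d := Metric.infDist_nonneg
  have hd1 : d ≤ 1 := h.trans hε₁₁
  obtain ⟨σ, hσ, hσa⟩ : ∃ σ : ℝ, (σ = 1 ∨ σ = -1) ∧ σ * a 2 = d ^ α := by
    rcases haz with haz | haz
    · exact ⟨1, Or.inl rfl, by rw [haz, one_mul]⟩
    · exact ⟨-1, Or.inr rfl, by rw [haz]; ring⟩
  have hdα : d = (d ^ α) ^ (1 / α) := by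
    rw [← Real.rpow_mul hd0, mul_one_div_cancel hα0.ne', Real.rpow_one]
  have hdα1 : d ^ α ≤ 1 := Real.rpow_le_one hd0 hd1 hα0.le
  have hβr : 0 < β * r := by positivity
  have hβr16 : β * r ≤ r / 16 := by nlinarith
  suffices hmain : ∃ u ≥ 0, ∀ z ∈ Icc u (u + β * r), |z - σ * a 2| ≤ r / 2 ∧
      z ^ (1 / α) ≤ ε₁ ∧ ∃ y ∈ levelSet Ω (z ^ (1 / α)), dist y (proj a) ≤ r / 4 by
    obtain ⟨u, hu, hz⟩ := hmain
    refine le_trans (ENNReal.ofReal_le_ofReal ?_) (ofReal_le_of_levelSets hα0 hσ hr hu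
      (l := β * r) fun z hzI => ?_)
    · calc min κ (β / 4) * r ^ 2 ≤ β / 4 * r ^ 2 := by gcongr; exact min_le_right _ _
        _ = _ := by ring
    · obtain ⟨h1, h2, h3⟩ := hz z hzI
      have h4 : 0 ≤ z ^ (1 / α) := Real.rpow_nonneg (le_trans hu hzI.1) _
      exact ⟨h1, isPreconnected_levelSet (hlev _ ⟨h4, h2.trans hε₁₀⟩), h3,
        hfar (proj a) r hrm _ h4 h2⟩
  -- If the height of the center is at least `βr`, take the window just below it: descending from
  -- the center moves at most `βr/α ≤ r/16`. Otherwise the center is within `βr` of the boundary,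
  -- and the window `[0, βr]` is reached from the nearest boundary point with `ρ = r/16`, where `β ≤
  -- c₁/16` admits all depths needed.
  rcases le_total (β * r) (d ^ α) with hcase | hcase
  · refine ⟨d ^ α - β * r, sub_nonneg.2 hcase, fun z hz => ?_⟩
    have hz0 : 0 ≤ z := (sub_nonneg.2 hcase).trans hz.1
    have hz1 : z ≤ d ^ α := by linarith [hz.2]
    have hzd : z ^ (1 / α) ≤ d := by
      rw [hdα]
      exact Real.rpow_le_rpow hz0 hz1 (by positivity)
    refine ⟨?_, hzd.trans h, ?_⟩
    · rw [hσa, abs_le]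
      constructor <;> linarith [hz.1]
    · obtain ⟨y, hy, hyd⟩ := hΩ.exists_mem_levelSet hax (Real.rpow_nonneg hz0 _) hzd
      refine ⟨y, hy, ?_⟩
      have h1 := sub_le_of_rpow hα le_rfl (Real.rpow_nonneg hz0 (1 / α)) hzd hd1
      rw [← Real.rpow_mul hz0, one_div_mul_cancel hα0.ne', Real.rpow_one] at h1
      rw [hyd]
      refine h1.trans ?_
      rw [div_mul_eq_mul_div, one_mul, div_le_iff₀ hα0]
      nlinarith [hz.1]
  · refine ⟨0, le_rfl, fun z hz => ?_⟩
    rw [zero_add] at hz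
    have hz1 : z ≤ 1 := by linarith [hz.2]
    have hzz := hrpow z hz.1 hz1
    have hdd : d ≤ β * r := by
      refine le_trans ?_ hcase
      calc d = (d ^ α) ^ (1 / α) := hdα
        _ ≤ d ^ α := hrpow _ (by positivity) hdα1
    refine ⟨?_, by linarith [hz.2], ?_⟩
    · rw [hσa, abs_le]
      have : 0 ≤ d ^ α := by positivity
      constructor <;> linarith [hz.1, hz.2]
    · obtain ⟨w, hw, hdw⟩ := hΩ.isCompact_frontier.exists_infDist_eq_dist hΩ.frontier_nonempty
        (proj a)
      obtain ⟨y, hy, hyw⟩ := hreach w hw (r / 16) ⟨by positivity, by linarith⟩ (z ^ (1 / α))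
        (Real.rpow_nonneg hz.1 _) (by nlinarith [hz.2])
      refine ⟨y, hy, ?_⟩
      rw [← hd] at hdw
      linarith [dist_triangle_right y (proj a) w]

/-! ### Global bounds and conclusion. -/

theorem exists_abs_height_le {Ω : Set Plane} (hΩ : IsJordanDomain Ω) {α : ℝ} (hα : 0 < α) :
    ∃ H, ∀ a ∈ doubleDome Ω α, |a 2| ≤ H := by
  obtain ⟨w, hw⟩ := hΩ.frontier_nonempty
  obtain ⟨D, hD⟩ := hΩ.isBounded.closure.subset_closedBall w
  refine ⟨D ^ α, ?_⟩
  intro a ha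
  obtain ⟨hax, haz⟩ := mem_doubleDome_iff.1 ha
  have h0 : 0 ≤ Metric.infDist (proj a) (frontier Ω) ^ α :=
    Real.rpow_nonneg Metric.infDist_nonneg _
  have h1 : |a 2| = Metric.infDist (proj a) (frontier Ω) ^ α := by
    rcases haz with h | h
    · rw [h, abs_of_nonneg h0]
    · rw [h, abs_neg, abs_of_nonneg h0]
  rw [h1]
  exact Real.rpow_le_rpow Metric.infDist_nonneg
    ((Metric.infDist_le_dist_of_mem hw).trans (hD hax)) hα.le

theorem isBounded_doubleDome {Ω : Set Plane} (hΩ : IsJordanDomain Ω) {α : ℝ} (hα : 0 < α) :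
    Bornology.IsBounded (doubleDome Ω α) := by
  obtain ⟨H, hheight⟩ := exists_abs_height_le hΩ hα
  have w : Plane := 0
  obtain ⟨D, hD⟩ := hΩ.isBounded.closure.subset_closedBall w
  refine (Metric.isBounded_closedBall (x := lift w 0) (r := D + H)).subset fun a ha => ?_
  have h1 : dist (proj a) w ≤ D := hD (mem_doubleDome_iff.1 ha).1
  have h2 := hheight a ha
  have h3 := dist_nonneg (x := proj a) (y := w)
  have h4 := abs_nonneg (a 2)
  rw [Metric.mem_closedBall]
  refine (sq_le_sq₀ dist_nonneg (by linarith)).1 ?_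
  rw [dist_space_sq, proj_lift, lift_two, sub_zero, ← sq_abs (a 2)]
  nlinarith [mul_nonneg h3 h4]

/-- Upper area bounds for all balls centered on the surface. -/
theorem exists_hausdorffMeasure_doubleDome_ball_le {Ω : Set Plane} (hΩ : IsJordanDomain Ω)
    (hL : HasLQC Ω) (hW : IsWeakChordArc (frontier Ω)) {α : ℝ} (hα : α ∈ Ioo (0 : ℝ) 1) :
    ∃ B > 0, ∀ a ∈ doubleDome Ω α, ∀ r > 0,
      μH[2] (doubleDome Ω α ∩ Metric.ball a r) ≤ ENNReal.ofReal (B * r ^ 2) := by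
  obtain ⟨K, f, hf, hfΓ⟩ := hL.exists_quasiconformal hΩ
  obtain ⟨H, hheight⟩ := exists_abs_height_le hΩ hα.1
  have hbdd := isBounded_doubleDome hΩ hα.1
  obtain ⟨B, hB, R₀, hR₀, hball⟩ := exists_hausdorffMeasure_ball_le hf (hfΓ ▸ hW)
    (H := H) hα
  rw [hfΓ] at hball
  have hsub : doubleDome Ω α ⊆ doubleGraph (frontier Ω) α := fun a ha => (mem_doubleDome_iff.1 ha).2
  have hfin : μH[2] (doubleDome Ω α) < ∞ := by
    have htb : TotallyBounded (doubleDome Ω α) :=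
      hbdd.isCompact_closure.totallyBounded.subset subset_closure
    obtain ⟨Y, hY, hYf, hcov⟩ := Metric.finite_approx_of_totallyBounded htb R₀ hR₀
    have hcov' : doubleDome Ω α ⊆ ⋃ y ∈ Y, doubleDome Ω α ∩ Metric.ball y R₀ := by
      intro x hx
      obtain ⟨y, hy, hxy⟩ := mem_iUnion₂.1 (hcov hx)
      exact mem_iUnion₂.2 ⟨y, hy, hx, hxy⟩
    refine (measure_mono hcov').trans_lt (measure_biUnion_lt_top hYf fun y hy => ?_)
    exact ((measure_mono (inter_subset_inter_left _ hsub)).trans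
      (hball y (hheight y (hY hy)) R₀ ⟨hR₀, le_rfl⟩)).trans_lt ENNReal.ofReal_lt_top
  set V := (μH[2] (doubleDome Ω α)).toReal with hV
  have hV0 : 0 ≤ V := ENNReal.toReal_nonneg
  refine ⟨B + V / R₀ ^ 2, by positivity, fun a ha r hr => ?_⟩
  -- For large radii the total area `V`, finite by total boundedness, is at most `(V / R₀²) r²`.
  rcases le_total r R₀ with h | h
  · refine (measure_mono (inter_subset_inter_left _ hsub)).trans
      ((hball a (hheight a ha) r ⟨hr, h⟩).trans (ENNReal.ofReal_le_ofReal ?_))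
    gcongr
    have : 0 ≤ V / R₀ ^ 2 := by positivity
    linarith
  · refine (measure_mono inter_subset_left).trans ?_
    rw [← ENNReal.ofReal_toReal hfin.ne]
    refine ENNReal.ofReal_le_ofReal ?_
    calc V = V / R₀ ^ 2 * R₀ ^ 2 := by field_simp
      _ ≤ (B + V / R₀ ^ 2) * r ^ 2 := by
        gcongr
        linarith

end DoubleDome

theorem proposition4p1 (Ω : Set DoubleDome.Plane) (hΩ : DoubleDome.IsJordanDomain Ω)
    (hLQC : DoubleDome.HasLQC Ω) (hWCA : DoubleDome.IsWeakChordArc (frontier Ω))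
    (α : ℝ) (hα : α ∈ Set.Ioo (0 : ℝ) 1) :
    DoubleDome.IsAhlforsRegular 2 (DoubleDome.doubleDome Ω α) := by
  obtain ⟨B, hB, hupper⟩ := DoubleDome.exists_hausdorffMeasure_doubleDome_ball_le hΩ hLQC hWCA hα
  obtain ⟨c, hc, R₀, hR₀, hlower⟩ := DoubleDome.exists_le_hausdorffMeasure_ball hΩ hLQC hα
  set S := DoubleDome.doubleDome Ω α with hS
  have hball : ∀ (a : S) (r : ℝ), μH[2] (Metric.ball a r) = μH[2] (S ∩ Metric.ball (a : _) r) := by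
    intro a r
    rw [← (isometry_subtype_coe (s := S)).hausdorffMeasure_image (Or.inl zero_le_two)]
    congr 1
    ext x
    simp [and_comm]
  have hfin : Metric.ediam (univ : Set S) ≠ ∞ := by
    have h := (DoubleDome.isBounded_doubleDome hΩ hα.1).ediam_ne_top
    rwa [← hS, ← Subtype.range_coe (s := S), ← image_univ,
      (isometry_subtype_coe (s := S)).ediam_image] at h
  set Δ := max (Metric.ediam (univ : Set S)).toReal R₀ with hΔ
  have hΔ0 : 0 < Δ := lt_max_of_lt_right hR₀
  -- Radii between `R₀` and the diameter are handled by the concentric ball of radius `R₀ ≥ (R₀ / Δ)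
  -- r`.
  set κ := c * (R₀ / Δ) ^ 2 with hκ
  have hκ0 : 0 < κ := by positivity
  have hRΔ : R₀ / Δ ≤ 1 := (div_le_one hΔ0).2 (le_max_right _ _)
  have hRΔ0 : 0 ≤ R₀ / Δ := by positivity
  refine ⟨1 + B + κ⁻¹, by linarith [inv_pos.2 hκ0], fun a r hr hrd => ⟨?_, ?_⟩⟩
  · have hrΔ : r ≤ Δ := ((ENNReal.ofReal_le_iff_le_toReal hfin).1 hrd).trans (le_max_left _ _)
    have h1 : (1 + B + κ⁻¹)⁻¹ * r ^ (2 : ℝ) ≤ κ * r ^ 2 := by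
      rw [Real.rpow_two]
      gcongr
      exact inv_le_of_inv_le₀ hκ0 (by linarith)
    rw [hball]
    rcases le_total r R₀ with h | h
    · refine le_trans (ENNReal.ofReal_le_ofReal (h1.trans ?_)) (hlower a a.2 r ⟨hr, h⟩)
      gcongr
      exact mul_le_of_le_one_right hc.le (pow_le_one₀ hRΔ0 hRΔ)
    · refine le_trans (ENNReal.ofReal_le_ofReal (h1.trans ?_)) ((hlower a a.2 R₀ ⟨hR₀, le_rfl⟩).trans
        (measure_mono (inter_subset_inter_right _ (Metric.ball_subset_ball h))))
      calc κ * r ^ 2 = c * (R₀ / Δ * r) ^ 2 := by rw [hκ]; ring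
        _ ≤ c * R₀ ^ 2 := by
          gcongr
          rw [div_mul_eq_mul_div, div_le_iff₀ hΔ0]
          gcongr
  · rw [hball]
    refine (hupper a a.2 r hr).trans (ENNReal.ofReal_le_ofReal ?_)
    rw [Real.rpow_two]
    gcongr
    linarith [inv_pos.2 hκ0]
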